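/- Let $\mathbf\Sigma=(N,\Sigma,\rho)$ be a stacky fan: $N$ is a finitely generated abelian group, $\rho\colon\mathbb Z^n\to N$, $e_i\mapsto\rho_i$, has finite cokernel, and $\Sigma$ is a rational simplicial fan in $N_{\mathbb Q}=N\otimes\mathbb Q$ whose rays are spanned, bijectively, by the images $\bar\rho_1,\dots,\bar\rho_n$ of the $\rho_i$. For a finitely generated abelian group $N$ and a homomorphism $\rho\colon\mathbb Z^k\to N$ write $\mathbb L=\ker\rho$ and let $\mathbb L^\vee=H^1(\mathrm{Cone}(\rho)^*)$ be its Gale dual (where $^*$ is the derived dual $R\mathrm{Hom}(-,\mathbb Z)$), with divisor map $\rho^\vee\colon(\mathbb Z^k)^*\to\mathbb L^\vee$ and canonical map $\mathbb L^\vee\to\mathbb L^*$. Let $\mathcal X=\mathcal X(\mathbf\Sigma)=[U/G]$ be the toric Deligne–Mumford stack over $\mathbb C$, where $U\subset\mathbb C^n$ consists of the points $z$ for which $\sum_{i:z_i=0}\mathbb R_{\ge0}\bar\rho_i$ is a cone of $\Sigma$, and $G=\mathrm{Hom}(\mathbb L^\vee,\mathbb C^\times)$ acts through the map $G\to(\mathbb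 C^\times)^n$ dual to $\rho^\vee$. $\mathrm{Pic}\,\mathcal X$ is the group of isomorphism classes of $G$-equivariant algebraic line bundles on $U$. Let $N_\Sigma=\{c\in N:\bar c\in|\Sigma|\}$, let $S=\{1,\dots,m\}$ be a finite set with a map $S\to N_\Sigma$, $j\mapsto s_j$, let $\sigma(j)$ be the minimal cone containing $\bar s_j$, write $\bar s_j=\sum_{i\in\sigma(j)}s_{ji}\bar\rho_i$, and let $r_j$ be the order of $s_j$ in $N/\sum_{i\in\sigma(j)}\mathbb Z\rho_i$. Let $b_j=s_j-\sum_i\lfloor s_{ji}\rfloor\rho_i\in\mathrm{Box}(\mathbf\Sigma)$ be the box element (connected component of the inertia stack) given by $s_j$. For a box element $b$, with $r_b$ the order of the corresponding automorphism, i.e. $b\colon B\mu_{r_b}\to\mathcal X$, the age of $L\in\mathrm{Pic}\,\mathcal X$ is $\mathrm{age}_b(L)=k/r_b$, where $0\le k<r_b$ and $\mu_{r_b}$ acts on $b^*L$ by the $k$-th power of its standard character. The $S$-extended Picard group is $$\mathrm{Pic}^S\mathcal X=\{(L,\varphi)\in\mathrm{Pic}\,\mathcal X\times\mathbb Q^S:\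 \varphi(j)+\mathrm{age}_{b_j}(L)\in\mathbb Z\ \text{ for all } j\in S\}.$$ Let $\rho^S\colon\mathbb Z^{n+m}\to N$ extend $\rho$ by $e_{n+j}\mapsto s_j$, let $\mathbb L^S=\ker\rho^S$, and let $\mathbb L^{S\vee}$ be the Gale dual of $\rho^S$. Let $\iota^*\colon\mathbb L^{S\vee}\to\mathbb L^\vee$ be the canonical map, and let $\mu^*\colon\mathbb L^{S\vee}\to(\mathbb L^S)^*\to\mathbb Q^m$ be dual to $\mu\colon\mathbb Q^m\to\mathbb L^S\otimes\mathbb Q$, $e_j\mapsto e_{n+j}-\sum_{i\in\sigma(j)}s_{ji}e_i$. **Proposition.** (1) The map $\mathbb L^\vee\to\mathrm{Pic}\,\mathcal X$ that sends $\xi$ to the line bundle $L_\xi=U\times\mathbb C$ on which $G$ acts through the character $\xi$ is an isomorphism. (2) $\mu^*$ takes values in $\bigoplus_j r_j^{-1}\mathbb Z$, and the sequence $$0\to\mathbb L^{S\vee}\xrightarrow{(\iota^*,\mu^*)}\mathbb L^\vee\oplus\bigoplus_{j=1}^m r_j^{-1}\mathbb Z\xrightarrow{(\mathrm{res},\mathrm{can})}\bigoplus_{j=1}^m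 r_j^{-1}\mathbb Z/\mathbb Z\to0$$ is exact, where $\mathrm{res}(\xi)_j=\mathrm{age}_{b_j}(L_\xi)\bmod\mathbb Z$ and $\mathrm{can}$ is the projection. (3) There is an isomorphism of groups $\Phi\colon\mathrm{Pic}^S\mathcal X\cong\mathbb L^{S\vee}$ such that, for all $(L,\varphi)\in\mathrm{Pic}^S\mathcal X$, $L_{\iota^*\Phi(L,\varphi)}\cong L$ and $\mu^*\Phi(L,\varphi)=\varphi$. -/

import Mathlib

open scoped TensorProduct

noncomputable section

/-! ### Zariski-open sets and regular functions

A (classical, complex) variety is handled through its set of points `X` together with an algebra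
`A` of functions on `X` (the restrictions to `X` of the polynomial functions of an ambient affine
variety). -/

/-- `V` is a union of principal open sets `{q ≠ 0}`, `q ∈ A`. -/
def IsZariskiOpen {X : Type*} (A : Subalgebra ℂ (X → ℂ)) (V : Set X) : Prop :=
  ∀ x ∈ V, ∃ q ∈ A, q x ≠ 0 ∧ ∀ y, q y ≠ 0 → y ∈ V

/-- `f` is locally on `V` a quotient of elements of `A`. -/
def IsRegularOn {X : Type*} (A : Subalgebra ℂ (X → ℂ)) (V : Set X) (f : X → ℂ) : Prop :=
  ∀ x ∈ V, ∃ p ∈ A, ∃ q ∈ A, q x ≠ 0 ∧ ∀ y ∈ V, q y ≠ 0 → f y = p y / q y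

namespace IsZariskiOpen

variable {X : Type*} {A : Subalgebra ℂ (X → ℂ)} {V W : Set X}

theorem univ : IsZariskiOpen A Set.univ :=
  fun _ _ => ⟨1, A.one_mem, by simp, fun _ _ => trivial⟩

theorem inter (hV : IsZariskiOpen A V) (hW : IsZariskiOpen A W) : IsZariskiOpen A (V ∩ W) := by
  rintro x ⟨hxV, hxW⟩
  obtain ⟨q, hq, hqx, hqV⟩ := hV x hxV
  obtain ⟨r, hr, hrx, hrW⟩ := hW x hxW
  refine ⟨q * r, A.mul_mem hq hr, mul_ne_zero hqx hrx, fun y hy => ⟨hqV y ?_, hrW y ?_⟩⟩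
  · exact left_ne_zero_of_mul hy
  · exact right_ne_zero_of_mul hy

end IsZariskiOpen

namespace IsRegularOn

variable {X : Type*} {A : Subalgebra ℂ (X → ℂ)} {V W : Set X} {f g : X → ℂ}

theorem of_mem (hf : f ∈ A) : IsRegularOn A V f :=
  fun _ _ => ⟨f, hf, 1, A.one_mem, by simp, fun _ _ _ => by simp⟩

theorem one : IsRegularOn A V (fun _ => 1) := of_mem A.one_mem

theorem mono (hf : IsRegularOn A V f) (h : W ⊆ V) : IsRegularOn A W f := by
  intro x hx
  obtain ⟨p, hp, q, hq, hqx, H⟩ := hf x (h hx)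
  exact ⟨p, hp, q, hq, hqx, fun y hy => H y (h hy)⟩

theorem mul (hf : IsRegularOn A V f) (hg : IsRegularOn A V g) :
    IsRegularOn A V (fun x => f x * g x) := by
  intro x hx
  obtain ⟨p, hp, q, hq, hqx, H⟩ := hf x hx
  obtain ⟨p', hp', q', hq', hqx', H'⟩ := hg x hx
  refine ⟨p * p', A.mul_mem hp hp', q * q', A.mul_mem hq hq', mul_ne_zero hqx hqx', ?_⟩
  intro y hy hyq
  have h1 : q y ≠ 0 := left_ne_zero_of_mul hyq
  have h2 : q' y ≠ 0 := right_ne_zero_of_mul hyq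
  simp only [H y hy h1, H' y hy h2, Pi.mul_apply]
  rw [div_mul_div_comm]

theorem inv {f : X → ℂˣ} (hf : IsRegularOn A V (fun x => (f x : ℂ))) :
    IsRegularOn A V (fun x => ((f x)⁻¹ : ℂˣ)) := by
  intro x hx
  obtain ⟨p, hp, q, hq, hqx, H⟩ := hf x hx
  have hpx : p x ≠ 0 := by
    intro h0
    have := H x hx hqx
    rw [h0, zero_div] at this
    exact (f x).ne_zero this
  refine ⟨q * q, A.mul_mem hq hq, p * q, A.mul_mem hp hq, mul_ne_zero hpx hqx, ?_⟩
  intro y hy hyq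
  have h1 : p y ≠ 0 := left_ne_zero_of_mul hyq
  have h2 : q y ≠ 0 := right_ne_zero_of_mul hyq
  simp only [Units.val_inv_eq_inv_val, H y hy h2, Pi.mul_apply]
  field_simp

end IsRegularOn

/-! ### The Picard group of a quotient stack `[X / G]`

Line bundles on `[X / G]` are `G`-equivariant line bundles on `X`.  Such a bundle is given by local
trivialisations over Zariski-open sets `V x ∋ x` (`x ∈ X`) together with transition functions
`a x y g z`: the isomorphism, from the fibre over `z ∈ V x` to the fibre over `g • z ∈ V y`, by
which `g` acts, read in the trivialisations over `V x` and `V y`. (For `g = 1` these are the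
transition functions of the underlying line bundle on `X`.) -/

section EquivariantPicard

variable {G X : Type*} [Group G] [MulAction G X]

/-- The algebra of functions on `G × X` generated by functions on the factors. -/
def prodAlgebra {G X : Type*} (B : Subalgebra ℂ (G → ℂ)) (A : Subalgebra ℂ (X → ℂ)) :
    Subalgebra ℂ (G × X → ℂ) :=
  Algebra.adjoin ℂ ({f | ∃ b ∈ B, f = fun w => b w.1} ∪ {f | ∃ a ∈ A, f = fun w => a w.2})

/-- A `G`-equivariant algebraic line bundle on `X`, presented by transition functions. -/
@[ext] structure EquivariantLineBundle (B : Subalgebra ℂ (G → ℂ)) (A : Subalgebra ℂ (X → ℂ)) where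
  V : X → Set X
  isOpen : ∀ x, IsZariskiOpen A (V x)
  mem : ∀ x, x ∈ V x
  a : X → X → G → X → ℂˣ
  regular : ∀ x y, IsRegularOn (prodAlgebra B A) {w | w.2 ∈ V x ∧ w.1 • w.2 ∈ V y}
    (fun w => (a x y w.1 w.2 : ℂ))
  cocycle : ∀ x y t g h z, z ∈ V x → g • z ∈ V y → (h * g) • z ∈ V t →
    a y t h (g • z) * a x y g z = a x t (h * g) z

namespace EquivariantLineBundle

variable {B : Subalgebra ℂ (G → ℂ)} {A : Subalgebra ℂ (X → ℂ)}

/-- The trivial bundle. -/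
instance : One (EquivariantLineBundle B A) where
  one :=
    { V := fun _ => Set.univ
      isOpen := fun _ => IsZariskiOpen.univ
      mem := fun _ => trivial
      a := fun _ _ _ _ => 1
      regular := fun _ _ => by simpa using IsRegularOn.one
      cocycle := fun _ _ _ _ _ _ _ _ _ => by simp }

/-- The tensor product: transition functions are multiplied. -/
instance : Mul (EquivariantLineBundle B A) where
  mul L M :=
    { V := fun x => L.V x ∩ M.V x
      isOpen := fun x => (L.isOpen x).inter (M.isOpen x)
      mem := fun x => ⟨L.mem x, M.mem x⟩
      a := fun x y g z => L.a x y g z * M.a x y g z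
      regular := fun x y => by
        have h1 := (L.regular x y).mono
          (W := {w : G × X | w.2 ∈ L.V x ∩ M.V x ∧ w.1 • w.2 ∈ L.V y ∩ M.V y})
          (fun w hw => ⟨hw.1.1, hw.2.1⟩)
        have h2 := (M.regular x y).mono
          (W := {w : G × X | w.2 ∈ L.V x ∩ M.V x ∧ w.1 • w.2 ∈ L.V y ∩ M.V y})
          (fun w hw => ⟨hw.1.2, hw.2.2⟩)
        simpa using h1.mul h2
      cocycle := fun x y t g h z hx hy ht => by
        rw [← L.cocycle x y t g h z hx.1 hy.1 ht.1, ← M.cocycle x y t g h z hx.2 hy.2 ht.2]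
        exact mul_mul_mul_comm _ _ _ _ }

/-- The dual bundle: transition functions are inverted. -/
instance : Inv (EquivariantLineBundle B A) where
  inv L :=
    { V := L.V
      isOpen := L.isOpen
      mem := L.mem
      a := fun x y g z => (L.a x y g z)⁻¹
      regular := fun x y => (L.regular x y).inv
      cocycle := fun x y t g h z hx hy ht => by
        rw [← L.cocycle x y t g h z hx hy ht, mul_inv] }

instance : CommMonoid (EquivariantLineBundle B A) where
  mul_assoc L M N := by
    ext1
    · funext x; exact Set.inter_assoc _ _ _
    · funext x y g z; exact mul_assoc _ _ _
  one_mul L := by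
    ext1
    · funext x; exact Set.univ_inter _
    · funext x y g z; exact one_mul _
  mul_one L := by
    ext1
    · funext x; exact Set.inter_univ _
    · funext x y g z; exact mul_one _
  mul_comm L M := by
    ext1
    · funext x; exact Set.inter_comm _ _
    · funext x y g z; exact mul_comm _ _

/-- An equivariant isomorphism of line bundles: on a common refinement `W` of the two covers it is
multiplication by invertible regular functions `b x`. -/
def Iso (L M : EquivariantLineBundle B A) : Prop :=
  ∃ (W : X → Set X) (b : X → X → ℂˣ),
    (∀ x, IsZariskiOpen A (W x)) ∧ (∀ x, x ∈ W x) ∧ (∀ x, W x ⊆ L.V x ∩ M.V x) ∧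
    (∀ x, IsRegularOn A (W x) (fun z => (b x z : ℂ))) ∧
    ∀ x y g z, z ∈ W x → g • z ∈ W y → M.a x y g z * b x z = b y (g • z) * L.a x y g z

/-- Isomorphism is a congruence for the tensor product. -/
def isoCon (B : Subalgebra ℂ (G → ℂ)) (A : Subalgebra ℂ (X → ℂ)) :
    Con (EquivariantLineBundle B A) where
  r := Iso
  iseqv :=
    { refl := fun L => ⟨L.V, fun _ _ => 1, L.isOpen, L.mem, fun x => by simp,
        fun x => by simpa using IsRegularOn.one, fun x y g z _ _ => by simp⟩
      symm := by
        rintro L M ⟨W, b, hW, hm, hs, hb, H⟩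
        refine ⟨W, fun x z => (b x z)⁻¹, hW, hm, fun x => ?_, fun x => (hb x).inv, ?_⟩
        · rw [Set.inter_comm]; exact hs x
        · intro x y g z hx hy
          have := H x y g z hx hy
          rw [mul_inv_eq_iff_eq_mul, mul_assoc, eq_inv_mul_iff_mul_eq, ← this]
      trans := by
        rintro L M N ⟨W, b, hW, hm, hs, hb, H⟩ ⟨W', b', hW', hm', hs', hb', H'⟩
        refine ⟨fun x => W x ∩ W' x, fun x z => b' x z * b x z, fun x => (hW x).inter (hW' x),
          fun x => ⟨hm x, hm' x⟩, fun x z hz => ⟨(hs x hz.1).1, (hs' x hz.2).2⟩, fun x => ?_, ?_⟩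
        · simpa using ((hb' x).mono Set.inter_subset_right).mul
            ((hb x).mono Set.inter_subset_left)
        · intro x y g z hx hy
          rw [← mul_assoc, H' x y g z hx.2 hy.2, mul_assoc, H x y g z hx.1 hy.1, mul_assoc] }
  mul' := by
    rintro L M L' M' ⟨W, b, hW, hm, hs, hb, H⟩ ⟨W', b', hW', hm', hs', hb', H'⟩
    refine ⟨fun x => W x ∩ W' x, fun x z => b x z * b' x z, fun x => (hW x).inter (hW' x),
      fun x => ⟨hm x, hm' x⟩,
      fun x z hz => ⟨⟨(hs x hz.1).1, (hs' x hz.2).1⟩, ⟨(hs x hz.1).2, (hs' x hz.2).2⟩⟩,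
      fun x => ?_, ?_⟩
    · simpa using ((hb x).mono Set.inter_subset_left).mul ((hb' x).mono Set.inter_subset_right)
    · intro x y g z hx hy
      change M.a x y g z * M'.a x y g z * (b x z * b' x z) =
        b y (g • z) * b' y (g • z) * (L.a x y g z * L'.a x y g z)
      rw [mul_mul_mul_comm, H x y g z hx.1 hy.1, H' x y g z hx.2 hy.2, mul_mul_mul_comm]

end EquivariantLineBundle

open EquivariantLineBundle

/-- The Picard group of `[X / G]`: isomorphism classes of `G`-equivariant line bundles on `X`,
with the tensor product. -/
def EquivariantPic (B : Subalgebra ℂ (G → ℂ)) (A : Subalgebra ℂ (X → ℂ)) : Type _ :=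
  (isoCon B A).Quotient

variable (B : Subalgebra ℂ (G → ℂ)) (A : Subalgebra ℂ (X → ℂ))

instance : CommMonoid (EquivariantPic B A) := inferInstanceAs (CommMonoid (isoCon B A).Quotient)

/-- The class of an equivariant line bundle. -/
def EquivariantPic.mk : EquivariantLineBundle B A →* EquivariantPic B A := (isoCon B A).mk'

theorem EquivariantPic.mk_inv_mul (L : EquivariantLineBundle B A) :
    EquivariantPic.mk B A (L⁻¹ * L) = 1 := by
  rw [← map_one (EquivariantPic.mk B A)]
  refine (Con.eq (isoCon B A)).2 ⟨L.V, fun _ _ => 1, L.isOpen, L.mem, fun x z hz => ?_, fun x => ?_,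
    fun x y g z _ _ => ?_⟩
  · exact ⟨⟨hz, hz⟩, trivial⟩
  · simpa using IsRegularOn.one
  · change (1 : ℂˣ) * 1 = 1 * ((L.a x y g z)⁻¹ * L.a x y g z)
    simp

instance : CommGroup (EquivariantPic B A) where
  inv := Quotient.map (fun L : EquivariantLineBundle B A => L⁻¹) (by
    rintro L M ⟨W, b, hW, hm, hs, hb, H⟩
    refine ⟨W, fun x z => (b x z)⁻¹, hW, hm, hs, fun x => (hb x).inv, ?_⟩
    intro x y g z hx hy
    have := congrArg (·⁻¹) (H x y g z hx hy)
    simp only [mul_inv] at this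
    exact this)
  inv_mul_cancel := by
    rintro ⟨L⟩
    exact EquivariantPic.mk_inv_mul B A L

/-- If `g` fixes `z`, then it acts on the fibre over `z` of an equivariant line bundle by a
scalar. -/
def EquivariantPic.fibreScalar (z : X) (g : G) (hg : g • z = z) : EquivariantPic B A →* ℂˣ :=
  (isoCon B A).lift
    { toFun := fun L => L.a z z g z
      map_one' := rfl
      map_mul' := fun _ _ => rfl }
    (by
      rintro L M ⟨W, b, hW, hm, hs, hb, H⟩
      have := H z z g z (hm z) (by rw [hg]; exact hm z)
      rw [hg, mul_comm] at this
      exact (mul_left_cancel this).symm)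

theorem EquivariantPic.fibreScalar_mk (z : X) (g : G) (hg : g • z = z)
    (L : EquivariantLineBundle B A) :
    EquivariantPic.fibreScalar B A z g hg (EquivariantPic.mk B A L) = L.a z z g z := rfl

theorem EquivariantPic.fibreScalar_pow (z : X) (g : G) (hg : g • z = z)
    (L : EquivariantPic B A) (r : ℕ) (hr : g ^ r = 1) :
    EquivariantPic.fibreScalar B A z g hg L ^ r = 1 := by
  obtain ⟨L, rfl⟩ : ∃ M, EquivariantPic.mk B A M = L := Con.mk'_surjective L
  have hfix : ∀ n : ℕ, g ^ n • z = z := fun n => by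
    induction n with
    | zero => simp
    | succ n ih => rw [pow_succ, mul_smul, hg, ih]
  have h1 : L.a z z 1 z = 1 := by
    have := L.cocycle z z z 1 1 z (L.mem z) (by simpa using L.mem z) (by simpa using L.mem z)
    rw [one_smul, mul_one] at this
    exact mul_eq_left.1 this
  have key : ∀ n : ℕ, L.a z z g z ^ n = L.a z z (g ^ n) z := fun n => by
    induction n with
    | zero => simp [h1]
    | succ n ih =>
      have := L.cocycle z z z g (g ^ n) z (L.mem z) (by rw [hg]; exact L.mem z)
        (by rw [← pow_succ, hfix]; exact L.mem z)
      rw [hg, ← pow_succ] at this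
      rw [pow_succ, ih, this]
  rw [fibreScalar_mk, key, hr, h1]

end EquivariantPicard

/-! ### Gale duality -/

section GaleDual

variable {ι N : Type*} [AddCommGroup N]

/-- The image `c̄ = 1 ⊗ c` of `c ∈ N` in `N_ℚ = ℚ ⊗ N`. -/
abbrev ratImage (c : N) : ℚ ⊗[ℤ] N := (1 : ℚ) ⊗ₜ[ℤ] c

/-- Reduction `ℚ → ℚ/ℤ`. -/
def modInt : ℚ →+ AddCircle (1 : ℚ) := QuotientAddGroup.mk' _

theorem modInt_eq_zero_iff {q : ℚ} : modInt q = 0 ↔ ∃ n : ℤ, (n : ℚ) = q := by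
  change ((q : ℚ) : AddCircle (1 : ℚ)) = 0 ↔ _
  rw [AddCircle.coe_eq_zero_iff]
  simp

/-- First differential of `Hom(Cone(ρ), [ℚ → ℚ/ℤ])`, on `Hom(N, ℚ)`. -/
def galeD0 (ρ : ι → N) : (N →+ ℚ) →+ (ι → ℚ) × (N →+ AddCircle (1 : ℚ)) where
  toFun η := (fun i => η (ρ i), modInt.comp η)
  map_zero' := by ext <;> simp
  map_add' η θ := by ext <;> simp

/-- Second differential of `Hom(Cone(ρ), [ℚ → ℚ/ℤ])`, on `Hom(ℤ^ι, ℚ) ⊕ Hom(N, ℚ/ℤ)`. -/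
def galeD1 (ρ : ι → N) : (ι → ℚ) × (N →+ AddCircle (1 : ℚ)) →+ (ι → AddCircle (1 : ℚ)) where
  toFun w i := modInt (w.1 i) - w.2 (ρ i)
  map_zero' := by ext; simp
  map_add' v w := by ext; simp [sub_add_sub_comm]

/-- The Gale dual `𝕃^∨ = H¹(Cone(ρ)^*)` of the homomorphism `ρ : ℤ^ι → N` with `e_i ↦ ρ i`.
Here `^*` is the derived dual `RHom(-, ℤ)`, computed with the injective resolution `ℚ → ℚ/ℤ` of `ℤ`,
and `Cone(ρ)` is the complex `ℤ^ι → N` in degrees `-1` and `0`. -/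
def GaleDual (ρ : ι → N) : Type _ :=
  (galeD1 ρ).ker ⧸ (galeD0 ρ).range.addSubgroupOf (galeD1 ρ).ker

instance (ρ : ι → N) : AddCommGroup (GaleDual ρ) :=
  inferInstanceAs (AddCommGroup ((galeD1 ρ).ker ⧸ (galeD0 ρ).range.addSubgroupOf (galeD1 ρ).ker))

namespace GaleDual

/-- The class of a cocycle. -/
def mk (ρ : ι → N) : (galeD1 ρ).ker →+ GaleDual ρ := QuotientAddGroup.mk' _

theorem mk_surjective (ρ : ι → N) : Function.Surjective (mk ρ) := QuotientAddGroup.mk'_surjective _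

/-- Homomorphisms out of the Gale dual. -/
def lift {M : Type*} [AddCommGroup M] (ρ : ι → N)
    (f : (ι → ℚ) × (N →+ AddCircle (1 : ℚ)) →+ M) (hf : ∀ η, f (galeD0 ρ η) = 0) :
    GaleDual ρ →+ M :=
  QuotientAddGroup.lift _ (f.comp (galeD1 ρ).ker.subtype) (by
    rintro ⟨w, hw⟩ ⟨η, hη⟩
    change f w = 0
    rw [← hf η, hη]
    rfl)

theorem lift_mk {M : Type*} [AddCommGroup M] (ρ : ι → N)
    (f : (ι → ℚ) × (N →+ AddCircle (1 : ℚ)) →+ M) (hf : ∀ η, f (galeD0 ρ η) = 0)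
    (w : (galeD1 ρ).ker) : lift ρ f hf (mk ρ w) = f w := rfl

/-- The divisor map `ρ^∨ : (ℤ^ι)^* → 𝕃^∨`. -/
def divisorMap (ρ : ι → N) : (ι → ℤ) →+ GaleDual ρ :=
  (mk ρ).comp
    { toFun := fun ξ => ⟨(fun i => (ξ i : ℚ), 0), by
        rw [AddMonoidHom.mem_ker]
        funext i
        change modInt (ξ i : ℚ) - 0 = 0
        rw [sub_zero, modInt_eq_zero_iff]
        exact ⟨ξ i, rfl⟩⟩
      map_zero' := by ext <;> simp
      map_add' := fun ξ ξ' => by ext <;> simp }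

/-- The map of Gale duals induced by `ℤ^κ → ℤ^ι`, `e_k ↦ e_{f k}`, and the identity of `N`. -/
def restrict {κ : Type*} (ρ : ι → N) (f : κ → ι) : GaleDual ρ →+ GaleDual (fun k => ρ (f k)) :=
  QuotientAddGroup.map _ _
    { toFun := fun w : (galeD1 ρ).ker =>
        (⟨(fun k => w.1.1 (f k), w.1.2), by
          have := w.2
          rw [AddMonoidHom.mem_ker] at this ⊢
          funext k
          exact congrFun this (f k)⟩ : (galeD1 (fun k => ρ (f k))).ker)
      map_zero' := rfl
      map_add' := fun _ _ => rfl }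
    (by
      rintro ⟨w, hw⟩ ⟨η, hη⟩
      refine ⟨η, ?_⟩
      change galeD0 ρ η = w at hη
      subst hη
      rfl)

theorem cocycle_eq (ρ : ι → N) (v : (galeD1 ρ).ker) (i : ι) : v.1.2 (ρ i) = modInt (v.1.1 i) := by
  have := congrFun (AddMonoidHom.mem_ker.1 v.2) i
  exact (sub_eq_zero.1 this).symm

section Pairing

variable [Fintype ι]

theorem hom_eq_sum (ρ : ι → N) (c : N) (w : ι → ℚ)
    (hw : ratImage c = ∑ i, w i • ratImage (ρ i)) (η : N →+ ℚ) :
    η c = ∑ i, w i * η (ρ i) := by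
  have := congrArg (LinearMap.liftBaseChange ℚ η.toIntLinearMap) hw
  simpa [map_sum] using this

/-- An element of `𝕃 ⊗ ℚ`, i.e. `w ∈ ℚ^ι` with `∑ wᵢ ρ̄ᵢ = 0`, defines, by the canonical map
`𝕃^∨ → 𝕃^*`, a linear form on `𝕃^∨`: on a cocycle `(u, χ)` its value is `∑ wᵢ uᵢ`. -/
def ratPairing (ρ : ι → N) (w : ι → ℚ) (hw : ∑ i, w i • ratImage (ρ i) = 0) :
    GaleDual ρ →+ ℚ :=
  lift ρ
    { toFun := fun v => ∑ i, w i * v.1 i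
      map_zero' := by simp
      map_add' := fun v v' => by simp [mul_add, Finset.sum_add_distrib] }
    (fun η => by
      have := hom_eq_sum ρ 0 w (by simp [ratImage, hw]) η
      rw [map_zero] at this
      exact this.symm)

/-- A relation `c̄ = ∑ wᵢ ρ̄ᵢ` in `N_ℚ` defines the homomorphism `𝕃^∨ → ℚ/ℤ` that sends the class of
a cocycle `(u, χ)` to `∑ wᵢ uᵢ - χ(c)`. -/
def circlePairing (ρ : ι → N) (c : N) (w : ι → ℚ)
    (hw : ratImage c = ∑ i, w i • ratImage (ρ i)) : GaleDual ρ →+ AddCircle (1 : ℚ) :=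
  lift ρ
    { toFun := fun v => modInt (∑ i, w i * v.1 i) - v.2 c
      map_zero' := by simp
      map_add' := fun v v' => by
        simp only [Prod.fst_add, Prod.snd_add, Pi.add_apply, mul_add, Finset.sum_add_distrib,
          map_add, AddMonoidHom.add_apply]
        abel }
    (fun η => by
      change modInt (∑ i, w i * η (ρ i)) - modInt (η c) = 0
      rw [hom_eq_sum ρ c w hw η, sub_self])

theorem circlePairing_mk (ρ : ι → N) (c : N) (w : ι → ℚ)
    (hw : ratImage c = ∑ i, w i • ratImage (ρ i)) (v : (galeD1 ρ).ker) :
    circlePairing ρ c w hw (mk ρ v) = modInt (∑ i, w i * v.1.1 i) - v.1.2 c := rfl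

end Pairing

end GaleDual

end GaleDual

/-! ### Roots of unity -/

/-- The homomorphism `ℚ/ℤ → ℂˣ`, `q ↦ exp(2πiq)`. -/
def expQ : AddCircle (1 : ℚ) →+ Additive ℂˣ :=
  QuotientAddGroup.lift _
    { toFun := fun q => Additive.ofMul
        (Units.mk0 (Complex.exp (2 * Real.pi * Complex.I * (q : ℂ))) (Complex.exp_ne_zero _))
      map_zero' := by
        apply Additive.toMul.injective
        ext
        simp
      map_add' := fun p q => by
        apply Additive.toMul.injective
        ext
        simp [mul_add, Complex.exp_add] }
    (by
      rintro x hx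
      obtain ⟨n, rfl⟩ := AddSubgroup.mem_zmultiples_iff.1 hx
      apply Additive.toMul.injective
      ext
      simp only [zsmul_eq_mul, mul_one, AddMonoidHom.coe_mk, ZeroHom.coe_mk, toMul_ofMul,
        Units.val_mk0, toMul_zero, Units.val_one]
      rw [Complex.exp_eq_one_iff]
      exact ⟨n, by push_cast; ring⟩)

theorem expQ_modInt (q : ℚ) : ((Additive.toMul (expQ (modInt q)) : ℂˣ) : ℂ) =
    Complex.exp (2 * Real.pi * Complex.I * (q : ℂ)) := rfl

theorem expQ_injective : Function.Injective expQ := by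
  rw [injective_iff_map_eq_zero]
  intro x hx
  obtain ⟨q, rfl⟩ : ∃ q, modInt q = x := QuotientAddGroup.mk'_surjective _ x
  have := expQ_modInt q
  rw [hx, toMul_zero, Units.val_one, eq_comm, Complex.exp_eq_one_iff] at this
  obtain ⟨n, hn⟩ := this
  refine modInt_eq_zero_iff.2 ⟨n, ?_⟩
  have h2 : (2 * (Real.pi : ℂ) * Complex.I) ≠ 0 := Complex.two_pi_I_ne_zero
  rw [mul_comm (n : ℂ)] at hn
  exact_mod_cast (mul_left_cancel₀ h2 hn).symm

/-- For an `r`-th root of unity `w`, the rational number `k / r` with `0 ≤ k < r` and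
`w = exp(2πi/r) ^ k`. -/
def rootAge (r : ℕ) (w : ℂˣ) : ℚ :=
  (sInf {k : ℕ | Complex.exp (2 * Real.pi * Complex.I / r) ^ k = (w : ℂ)} : ℕ) / r

theorem rootAge_spec {r : ℕ} (hr : r ≠ 0) {w : ℂˣ} (hw : w ^ r = 1) :
    ∃ k : ℕ, k < r ∧ Complex.exp (2 * Real.pi * Complex.I / r) ^ k = (w : ℂ) ∧
      rootAge r w = k / r := by
  have : NeZero r := ⟨hr⟩
  obtain ⟨i, hi, hiw⟩ := (Complex.isPrimitiveRoot_exp r hr).eq_pow_of_pow_eq_one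
    (ξ := (w : ℂ)) (by rw [← Units.val_pow_eq_pow_val, hw, Units.val_one])
  have hne : {k : ℕ | Complex.exp (2 * Real.pi * Complex.I / r) ^ k = (w : ℂ)}.Nonempty := ⟨i, hiw⟩
  exact ⟨_, lt_of_le_of_lt (Nat.sInf_le hiw) hi, Nat.sInf_mem hne, rfl⟩

theorem expQ_rootAge {r : ℕ} (hr : r ≠ 0) {w : ℂˣ} (hw : w ^ r = 1) :
    expQ (modInt (rootAge r w)) = Additive.ofMul w := by
  obtain ⟨k, -, hk, hage⟩ := rootAge_spec hr hw
  apply Additive.toMul.injective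
  ext
  rw [expQ_modInt, hage, toMul_ofMul, ← hk, ← Complex.exp_nat_mul]
  congr 1
  push_cast
  ring

/-! ### Stacky fans -/

/-- A stacky fan: a finitely generated abelian group `N`, a homomorphism `ρ : ℤ^ι → N` with finite
cokernel, given by the images `ray i = ρ(e_i)`, and a rational simplicial fan in `N_ℚ` whose rays
are spanned by the `ρ̄_i`.  Each cone of the fan is identified with the set `σ` of those `i` with
`ρ̄_i` in it, so that the cone is the set of nonnegative combinations of the `ρ̄_i`, `i ∈ σ`. -/
structure StackyFan (N : Type*) [AddCommGroup N] [Module.Finite ℤ N]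
    (ι : Type*) [Fintype ι] [DecidableEq ι] where
  ray : ι → N
  finite_coker : Finite (N ⧸ AddSubgroup.closure (Set.range ray))
  cones : Set (Finset ι)
  empty_mem : ∅ ∈ cones
  singleton_mem : ∀ i, {i} ∈ cones
  face_mem : ∀ σ ∈ cones, ∀ τ ⊆ σ, τ ∈ cones
  simplicial : ∀ σ ∈ cones, LinearIndepOn ℚ (fun i => ratImage (ray i)) (σ : Set ι)
  inter : ∀ σ ∈ cones, ∀ τ ∈ cones, ∀ x : ℚ ⊗[ℤ] N,
    (∃ a : ι → ℚ, (∀ i, 0 ≤ a i) ∧ x = ∑ i ∈ σ, a i • ratImage (ray i)) →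
    (∃ a : ι → ℚ, (∀ i, 0 ≤ a i) ∧ x = ∑ i ∈ τ, a i • ratImage (ray i)) →
    ∃ a : ι → ℚ, (∀ i, 0 ≤ a i) ∧ x = ∑ i ∈ σ ∩ τ, a i • ratImage (ray i)

theorem exists_smul_of_ratImage_eq_zero {N : Type*} [AddCommGroup N] {x : N} (hx : ratImage x = 0) :
    ∃ d : ℤ, d ≠ 0 ∧ d • x = 0 := by
  obtain ⟨s, hs⟩ := (IsLocalizedModule.eq_zero_iff (nonZeroDivisors ℤ)
    (TensorProduct.mk ℤ ℚ N 1)).1 hx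
  exact ⟨s, nonZeroDivisors.ne_zero s.2, hs⟩

theorem ratImage_sub {N : Type*} [AddCommGroup N] (x y : N) :
    ratImage (x - y) = ratImage x - ratImage y := TensorProduct.tmul_sub _ _ _

namespace StackyFan

variable {N : Type*} [AddCommGroup N] [Module.Finite ℤ N] {ι : Type*} [Fintype ι] [DecidableEq ι]
  (F : StackyFan N ι)

/-! #### The toric stack and its Picard group -/

/-- The anti-cones. -/
def antiCones : Set (Finset ι) := {I | Iᶜ ∈ F.cones}

/-- `U = ℂ^ι ∖ ⋃ ℂ^I`, the union over all `I` that are not anti-cones; `ℂ^I` is given by the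
equations `z_i = 0`, `i ∉ I`. -/
def U : Set (ι → ℂ) := {z | ∀ I ∉ F.antiCones, ¬ ∀ i ∉ I, z i = 0}

/-- The group `G = Hom(𝕃^∨, ℂˣ)`. -/
def G : Type _ := Multiplicative (GaleDual F.ray) →* ℂˣ

instance : CommGroup F.G := inferInstanceAs (CommGroup (Multiplicative (GaleDual F.ray) →* ℂˣ))

/-- The value at `g ∈ G` of the character of `G` given by `ξ ∈ 𝕃^∨`. -/
def character (ξ : GaleDual F.ray) : F.G →* ℂˣ where
  toFun g := (show Multiplicative (GaleDual F.ray) →* ℂˣ from g) (Multiplicative.ofAdd ξ)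
  map_one' := rfl
  map_mul' _ _ := rfl

/-- The classes `D_i = ρ^∨(u_i)` of the toric divisors. -/
def divisor (i : ι) : GaleDual F.ray := GaleDual.divisorMap F.ray (Pi.single i 1)

/-- `G` acts on `U` through the homomorphism `α : G → (ℂˣ)^ι` dual to `ρ^∨`. -/
instance : MulAction F.G F.U where
  smul g z := ⟨fun i => (F.character (F.divisor i) g : ℂ) * z.1 i, fun I hI h =>
    z.2 I hI fun i hi => (mul_eq_zero.1 (h i hi)).resolve_left (Units.ne_zero _)⟩
  one_smul z := Subtype.ext (funext fun i => by
    change ((F.character (F.divisor i) 1 : ℂˣ) : ℂ) * z.1 i = z.1 i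
    rw [map_one, Units.val_one, one_mul])
  mul_smul g h z := Subtype.ext (funext fun i => by
    change ((F.character (F.divisor i) (g * h) : ℂˣ) : ℂ) * z.1 i =
      (F.character (F.divisor i) g : ℂ) * ((F.character (F.divisor i) h : ℂ) * z.1 i)
    rw [map_mul, Units.val_mul, mul_assoc])

theorem smul_apply (g : F.G) (z : F.U) (i : ι) :
    (g • z).1 i = (F.character (F.divisor i) g : ℂ) * z.1 i := rfl

/-- The coordinate ring `ℂ[𝕃^∨]` of the algebraic group `G`. -/
def coordG : Subalgebra ℂ (F.G → ℂ) :=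
  Algebra.adjoin ℂ (Set.range fun ξ : GaleDual F.ray => fun g : F.G => (F.character ξ g : ℂ))

/-- The restrictions to `U` of the polynomial functions on `ℂ^ι`. -/
def coordU : Subalgebra ℂ (F.U → ℂ) :=
  Algebra.adjoin ℂ (Set.range fun i : ι => fun z : F.U => z.1 i)

/-- The Picard group of the toric stack `[U / G]`, written additively. -/
abbrev Pic : Type _ := Additive (EquivariantPic F.coordG F.coordU)

/-- The line bundle `U × ℂ` on which `G` acts by `g (z, v) = (g z, ξ(g) v)`, for `ξ ∈ 𝕃^∨`. -/
def characterBundle (ξ : GaleDual F.ray) : EquivariantLineBundle F.coordG F.coordU where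
  V _ := Set.univ
  isOpen _ := IsZariskiOpen.univ
  mem _ := trivial
  a _ _ g _ := F.character ξ g
  regular _ _ := IsRegularOn.of_mem (Algebra.subset_adjoin
    (Or.inl ⟨fun g => (F.character ξ g : ℂ), Algebra.subset_adjoin ⟨ξ, rfl⟩, rfl⟩))
  cocycle _ _ _ _ _ _ _ _ _ := by rw [map_mul]

/-- The canonical homomorphism `𝕃^∨ → Pic`. -/
def toPic : GaleDual F.ray →+ F.Pic where
  toFun ξ := Additive.ofMul (EquivariantPic.mk _ _ (F.characterBundle ξ))
  map_zero' := by
    have : F.characterBundle 0 = 1 := by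
      ext1
      · rfl
      · funext _ _ g _
        exact map_one (show Multiplicative (GaleDual F.ray) →* ℂˣ from g)
    rw [this, map_one, ofMul_one]
  map_add' ξ η := by
    have : F.characterBundle (ξ + η) = F.characterBundle ξ * F.characterBundle η := by
      ext1
      · funext _
        exact (Set.univ_inter _).symm
      · funext _ _ g _
        exact map_mul (show Multiplicative (GaleDual F.ray) →* ℂˣ from g) _ _
    rw [this, map_mul, ofMul_mul]

/-! #### Elements of `N_Σ` and box elements -/

/-- `N_Σ`: the elements `c` of `N` with `c̄` in some cone of the fan. -/
def NSigma : Set N :=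
  {c | ∃ σ ∈ F.cones, ∃ a : ι → ℚ, (∀ i, 0 ≤ a i) ∧
    ratImage c = ∑ i ∈ σ, a i • ratImage (F.ray i)}

/-- `Box(Σ)`. -/
def Box : Set N :=
  {b | ∃ σ ∈ F.cones, ∃ a : ι → ℚ, (∀ i, 0 ≤ a i ∧ a i < 1) ∧
    ratImage b = ∑ i ∈ σ, a i • ratImage (F.ray i)}

theorem box_subset : F.Box ⊆ F.NSigma := by
  rintro b ⟨σ, hσ, a, ha, hb⟩
  exact ⟨σ, hσ, a, fun i => (ha i).1, hb⟩

/-- The expansion `c̄ = ∑ aᵢ ρ̄ᵢ` over a cone of the fan. -/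
def IsExpansion (c : N) (a : ι → ℚ) : Prop :=
  (∀ i, 0 ≤ a i) ∧ Finset.univ.filter (fun i => a i ≠ 0) ∈ F.cones ∧
    ratImage c = ∑ i, a i • ratImage (F.ray i)

theorem exists_expansion (c : F.NSigma) : ∃ a, F.IsExpansion c.1 a := by
  obtain ⟨c, σ, hσ, a, ha, hc⟩ := c
  refine ⟨fun i => if i ∈ σ then a i else 0, fun i => ?_, F.face_mem σ hσ _ ?_, ?_⟩
  · dsimp only
    split_ifs
    exacts [ha i, le_rfl]
  · intro i hi
    by_contra h
    simp [h] at hi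
  · rw [hc]
    simp [ite_smul, Finset.sum_ite_mem]

theorem expansion_unique {c : N} {a b : ι → ℚ} (ha : F.IsExpansion c a) (hb : F.IsExpansion c b) :
    a = b := by
  have key : ∀ {a : ι → ℚ}, F.IsExpansion c a → ∀ {τ : Finset ι},
      (∃ v : ι → ℚ, (∀ i, 0 ≤ v i) ∧ ratImage c = ∑ i ∈ τ, v i • ratImage (F.ray i)) →
      τ ⊆ Finset.univ.filter (fun i => a i ≠ 0) →
      ∃ v : ι → ℚ, ratImage c = ∑ i ∈ τ, v i • ratImage (F.ray i) ∧
        ∀ i, a i = if i ∈ τ then v i else 0 := by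
    rintro a ⟨-, hσ, hsum⟩ τ ⟨v, -, hv⟩ hτ
    refine ⟨v, hv, ?_⟩
    have hli := linearIndepOn_finset_iff.1 (F.simplicial _ hσ)
      (fun i => a i - if i ∈ τ then v i else 0) (by
        simp only [sub_smul, Finset.sum_sub_distrib, ite_smul, zero_smul, Finset.sum_ite_mem]
        rw [Finset.inter_eq_right.2 hτ, ← hv, hsum, sub_eq_zero, Finset.sum_filter]
        refine Finset.sum_congr rfl fun i _ => ?_
        split_ifs with h
        · rfl
        · simp [not_not.1 h])
    intro i
    by_cases hi : a i = 0
    · have : i ∉ τ := fun h => by simpa [hi] using hτ h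
      simp [hi, this]
    · exact sub_eq_zero.1 (hli i (by simp [hi]))
  have cone : ∀ {a : ι → ℚ}, F.IsExpansion c a →
      ∃ v : ι → ℚ, (∀ i, 0 ≤ v i) ∧ ratImage c =
        ∑ i ∈ Finset.univ.filter (fun i => a i ≠ 0), v i • ratImage (F.ray i) := by
    rintro a ⟨h0, -, hsum⟩
    refine ⟨a, h0, ?_⟩
    rw [hsum, Finset.sum_filter]
    refine Finset.sum_congr rfl fun i _ => ?_
    split_ifs with h
    · rfl
    · simp [not_not.1 h]
  have hint := F.inter _ ha.2.1 _ hb.2.1 _ (cone ha) (cone hb)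
  obtain ⟨v, hv, hav⟩ := key ha hint Finset.inter_subset_left
  obtain ⟨w, hw, hbw⟩ := key hb hint Finset.inter_subset_right
  have hvw := linearIndepOn_finset_iff.1
    (F.simplicial _ (F.face_mem _ ha.2.1 _ (Finset.inter_subset_left (s₂ :=
      Finset.univ.filter (fun i => b i ≠ 0))))) (fun i => v i - w i) (by
        simp only [sub_smul, Finset.sum_sub_distrib]
        rw [← hv, ← hw, sub_self])
  funext i
  rw [hav, hbw]
  split_ifs with h
  · exact sub_eq_zero.1 (hvw i h)
  · rfl

/-- The nonnegative rational coefficients in the expansion of `c̄`, `c ∈ N_Σ`, over a cone. -/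
def coeff (c : F.NSigma) : ι → ℚ := (F.exists_expansion c).choose

theorem coeff_spec (c : F.NSigma) : F.IsExpansion c.1 (F.coeff c) :=
  (F.exists_expansion c).choose_spec

/-- The minimal cone containing `c̄`: it is spanned by the `ρ̄ᵢ` with positive coefficient. -/
def minCone (c : F.NSigma) : Finset ι := Finset.univ.filter (fun i => F.coeff c i ≠ 0)

/-- The order of `c ∈ N_Σ` in `N / ∑ ℤ ρ_i`, the sum over the minimal cone containing `c̄`. -/
def ord (c : F.NSigma) : ℕ :=
  addOrderOf (c.1 : N ⧸ AddSubgroup.closure (F.ray '' (F.minCone c : Set ι)))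

theorem ratImage_sum_zsmul (k : ι → ℤ) :
    ratImage (∑ i, k i • F.ray i) = ∑ i, (k i : ℚ) • ratImage (F.ray i) := by
  simp only [ratImage, TensorProduct.tmul_sum, TensorProduct.tmul_smul, Int.cast_smul_eq_zsmul]

theorem ord_ne_zero (c : F.NSigma) : F.ord c ≠ 0 := by
  obtain ⟨h0, hσ, hsum⟩ := F.coeff_spec c
  set D : ℤ := ∏ i, ((F.coeff c i).den : ℤ) with hD
  have hD0 : D ≠ 0 := Finset.prod_ne_zero_iff.2 fun i _ => by simp
  have hk : ∀ i, ∃ k : ℤ, (k : ℚ) = D * F.coeff c i := fun i => by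
    obtain ⟨e, he⟩ : ((F.coeff c i).den : ℤ) ∣ D := Finset.dvd_prod_of_mem _ (Finset.mem_univ i)
    refine ⟨e * (F.coeff c i).num, ?_⟩
    have := Rat.den_mul_eq_num (F.coeff c i)
    rw [he]
    push_cast
    rw [← this]
    ring
  choose k hk using hk
  have h1 : ratImage (D • c.1 - ∑ i, k i • F.ray i) = 0 := by
    have h2 : ratImage (D • c.1) = (D : ℚ) • ratImage c.1 := by
      simp only [ratImage, TensorProduct.tmul_smul, Int.cast_smul_eq_zsmul]
    rw [ratImage_sub, h2, hsum, F.ratImage_sum_zsmul, Finset.smul_sum, sub_eq_zero]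
    refine Finset.sum_congr rfl fun i _ => ?_
    rw [hk, smul_smul]
  obtain ⟨d, hd, hdx⟩ := exists_smul_of_ratImage_eq_zero h1
  have hmem : (d * D) • c.1 ∈ AddSubgroup.closure (F.ray '' (F.minCone c : Set ι)) := by
    rw [smul_sub, sub_eq_zero, smul_smul] at hdx
    rw [hdx]
    refine AddSubgroup.zsmul_mem _ (AddSubgroup.sum_mem _ fun i _ => ?_) _
    by_cases hi : F.coeff c i = 0
    · have : k i = 0 := by
        have := hk i
        rw [hi, mul_zero] at this
        exact_mod_cast this
      rw [this, zero_smul]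
      exact AddSubgroup.zero_mem _
    · exact AddSubgroup.zsmul_mem _ (AddSubgroup.subset_closure
        (Set.mem_image_of_mem _ (by simp [minCone, hi]))) _
  rw [ord, Ne, addOrderOf_eq_zero_iff, not_not, isOfFinAddOrder_iff_zsmul_eq_zero]
  refine ⟨d * D, mul_ne_zero hd hD0, ?_⟩
  rw [← QuotientAddGroup.mk_zsmul]
  exact (QuotientAddGroup.eq_zero_iff _).2 hmem

theorem exists_int_of_ord (c : F.NSigma) :
    ∃ k : ι → ℤ, F.ord c • c.1 = ∑ i, k i • F.ray i ∧ ∀ i, (F.ord c : ℚ) * F.coeff c i = k i := by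
  have hmem : F.ord c • c.1 ∈ AddSubgroup.closure (F.ray '' (F.minCone c : Set ι)) := by
    rw [← QuotientAddGroup.eq_zero_iff, QuotientAddGroup.mk_nsmul]
    exact addOrderOf_nsmul_eq_zero _
  have hex : ∀ x ∈ AddSubgroup.closure (F.ray '' (F.minCone c : Set ι)),
      ∃ k : ι → ℤ, (∀ i ∉ F.minCone c, k i = 0) ∧ x = ∑ i, k i • F.ray i := by
    intro x hx
    induction hx using AddSubgroup.closure_induction with
    | mem x hx =>
      obtain ⟨i, hi, rfl⟩ := hx
      refine ⟨Pi.single i 1, fun j hj => ?_, ?_⟩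
      · rw [Pi.single_apply, if_neg]
        rintro rfl
        exact hj hi
      · simp [Pi.single_apply]
    | zero => exact ⟨0, by simp, by simp⟩
    | add x y _ _ hx hy =>
      obtain ⟨k, hk, rfl⟩ := hx
      obtain ⟨l, hl, rfl⟩ := hy
      exact ⟨k + l, fun i hi => by simp [hk i hi, hl i hi],
        by simp [add_smul, Finset.sum_add_distrib]⟩
    | neg x _ hx =>
      obtain ⟨k, hk, rfl⟩ := hx
      exact ⟨-k, fun i hi => by simp [hk i hi], by simp⟩
  obtain ⟨k, hk, hsum⟩ := hex _ hmem
  refine ⟨k, hsum, ?_⟩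
  obtain ⟨h0, hσ, hc⟩ := F.coeff_spec c
  have himg : (F.ord c : ℚ) • ratImage c.1 = ∑ i, (k i : ℚ) • ratImage (F.ray i) := by
    rw [← F.ratImage_sum_zsmul, ← hsum, ratImage, ratImage, TensorProduct.tmul_smul,
      Nat.cast_smul_eq_nsmul]
  have hli := linearIndepOn_finset_iff.1 (F.simplicial _ hσ)
    (fun i => (F.ord c : ℚ) * F.coeff c i - k i) (by
      rw [Finset.sum_filter]
      rw [hc, Finset.smul_sum, ← sub_eq_zero, ← Finset.sum_sub_distrib] at himg
      refine Eq.trans ?_ himg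
      refine Finset.sum_congr rfl fun i _ => ?_
      split_ifs with h
      · rw [sub_smul, mul_smul]
      · have : k i = 0 := hk i (by simpa [minCone] using h)
        rw [not_not.1 h, this]
        simp)
  intro i
  by_cases hi : F.coeff c i = 0
  · rw [hi, mul_zero, hk i (by simp [minCone, hi]), Int.cast_zero]
  · exact sub_eq_zero.1 (hli i (by simp [hi]))

/-- The projection `N_Σ → Box(Σ)`, `c ↦ c - ∑ ⌊cᵢ⌋ ρᵢ`, where `c̄ = ∑ cᵢ ρ̄ᵢ`. -/
def toBox (c : F.NSigma) : F.Box :=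
  ⟨c.1 - ∑ i, ⌊F.coeff c i⌋ • F.ray i, F.minCone c, (F.coeff_spec c).2.1,
    fun i => Int.fract (F.coeff c i), fun i => ⟨Int.fract_nonneg _, Int.fract_lt_one _⟩, by
      rw [ratImage_sub, F.ratImage_sum_zsmul,
        (F.coeff_spec c).2.2, ← Finset.sum_sub_distrib, minCone, Finset.sum_filter]
      refine Finset.sum_congr rfl fun i _ => ?_
      split_ifs with h
      · rw [← sub_smul, Int.self_sub_floor]
      · simp [not_not.1 h]⟩

/-- A box element as an element of `N_Σ`. -/
def boxIncl (b : F.Box) : F.NSigma := ⟨b.1, F.box_subset b.2⟩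

theorem coeff_boxIncl_toBox (c : F.NSigma) (i : ι) :
    F.coeff (F.boxIncl (F.toBox c)) i = Int.fract (F.coeff c i) := by
  refine congrFun (F.expansion_unique (b := fun i => Int.fract (F.coeff c i))
    (F.coeff_spec (F.boxIncl (F.toBox c))) ⟨fun i => Int.fract_nonneg _, ?_, ?_⟩) i
  · refine F.face_mem _ (F.coeff_spec c).2.1 _ fun i hi => ?_
    simp only [Finset.mem_filter, Finset.mem_univ, true_and] at hi ⊢
    intro h
    simp [h] at hi
  · change ratImage (c.1 - ∑ i, ⌊F.coeff c i⌋ • F.ray i) = _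
    rw [ratImage_sub, F.ratImage_sum_zsmul,
      (F.coeff_spec c).2.2, ← Finset.sum_sub_distrib]
    refine Finset.sum_congr rfl fun i _ => ?_
    rw [← sub_smul, Int.self_sub_floor]

/-! #### The inertia stack and ages -/

/-- The homomorphism `𝕃^∨ → ℚ/ℤ` attached to `c ∈ N_Σ`; on the class of a cocycle `(u, χ)` it is
`∑ cᵢ uᵢ - χ(c)`, where `c̄ = ∑ cᵢ ρ̄ᵢ`. -/
def boxCharacter (c : F.NSigma) : GaleDual F.ray →+ AddCircle (1 : ℚ) :=
  GaleDual.circlePairing F.ray c.1 (F.coeff c) (F.coeff_spec c).2.2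

/-- The element `ξ ↦ exp(2πi ⟨ξ, b⟩)` of `G` corresponding to `b`; its image in `(ℂˣ)^ι` is
`exp(2πi bᵢ)`, where `b̄ = ∑ bᵢ ρ̄ᵢ`. -/
def boxElement (b : F.NSigma) : F.G where
  toFun ξ := Additive.toMul (expQ (F.boxCharacter b ξ.toAdd))
  map_one' := by simp
  map_mul' ξ η := by simp

theorem character_boxElement (b : F.NSigma) (ξ : GaleDual F.ray) :
    F.character ξ (F.boxElement b) = Additive.toMul (expQ (F.boxCharacter b ξ)) := rfl

theorem character_divisor_boxElement (b : F.NSigma) (i : ι) :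
    (F.character (F.divisor i) (F.boxElement b) : ℂ) =
      Complex.exp (2 * Real.pi * Complex.I * (F.coeff b i : ℂ)) := by
  rw [character_boxElement, ← expQ_modInt]
  congr 3
  change modInt (∑ j, F.coeff b j * ((Pi.single i 1 : ι → ℤ) j : ℚ)) - 0 = _
  rw [sub_zero]
  congr 1
  simp [Pi.single_apply]

/-- A point of `U` that lies in the component `{z | z_i = 0 for i ∈ σ(b)}` of the inertia stack
indexed by `b` and on no smaller torus-invariant stratum. -/
def boxPoint (b : F.NSigma) : F.U :=
  ⟨fun i => if i ∈ F.minCone b then 0 else 1, fun I hI h => hI (F.face_mem _ (F.coeff_spec b).2.1 _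
    fun i hi => by
      by_contra h'
      have := h i (Finset.mem_compl.1 hi)
      exact one_ne_zero ((if_neg h').symm.trans this))⟩

theorem boxElement_smul_boxPoint (b : F.NSigma) : F.boxElement b • F.boxPoint b = F.boxPoint b := by
  apply Subtype.ext
  funext i
  rw [smul_apply, character_divisor_boxElement]
  by_cases h : i ∈ F.minCone b
  · simp [boxPoint, h]
  · have : F.coeff b i = 0 := by simpa [minCone] using h
    simp [this]

/-- The order `r_b` of a box element: the order of the corresponding automorphism, i.e. the `r` for
which the box element is a representable morphism from `Bμ_r` to the stack. -/
def boxOrder (b : F.Box) : ℕ := orderOf (F.boxElement (F.boxIncl b))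

/-- The scalar by which the generator `exp(2πi/r_b)` of `μ_{r_b}` acts on `b^* L`, i.e. on the
fibre of `L` at a point of the component of the inertia stack indexed by `b`. -/
def boxScalar (b : F.Box) : EquivariantPic F.coordG F.coordU →* ℂˣ :=
  EquivariantPic.fibreScalar _ _ (F.boxPoint (F.boxIncl b)) (F.boxElement (F.boxIncl b))
    (F.boxElement_smul_boxPoint _)

/-- The age of a line bundle at a box element: `k / r_b`, where `0 ≤ k < r_b` and `μ_{r_b}` acts on
`b^* L` by the `k`-th power of its standard character. -/
def age (b : F.Box) (L : F.Pic) : ℚ := rootAge (F.boxOrder b) (F.boxScalar b L.toMul)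

theorem boxCharacter_toBox (c : F.NSigma) :
    F.boxCharacter (F.boxIncl (F.toBox c)) = F.boxCharacter c := by
  ext ξ
  obtain ⟨v, rfl⟩ := GaleDual.mk_surjective _ ξ
  rw [boxCharacter, boxCharacter, GaleDual.circlePairing_mk, GaleDual.circlePairing_mk]
  have h1 : v.1.2 (F.boxIncl (F.toBox c)).1 =
      v.1.2 c.1 - modInt (∑ i, (⌊F.coeff c i⌋ : ℚ) * v.1.1 i) := by
    change v.1.2 (c.1 - ∑ i, ⌊F.coeff c i⌋ • F.ray i) = _
    rw [map_sub, map_sum, map_sum]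
    congr 1
    refine Finset.sum_congr rfl fun i _ => ?_
    rw [map_zsmul, GaleDual.cocycle_eq, ← map_zsmul, zsmul_eq_mul]
  rw [h1]
  simp only [coeff_boxIncl_toBox, Int.fract, sub_mul, Finset.sum_sub_distrib, map_sub]
  abel

theorem boxElement_toBox (c : F.NSigma) :
    F.boxElement (F.boxIncl (F.toBox c)) = F.boxElement c := by
  refine MonoidHom.ext fun ξ => ?_
  change Additive.toMul (expQ (F.boxCharacter (F.boxIncl (F.toBox c)) ξ.toAdd)) = _
  rw [boxCharacter_toBox]
  rfl

theorem ord_nsmul_boxCharacter (c : F.NSigma) (ξ : GaleDual F.ray) :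
    F.ord c • F.boxCharacter c ξ = 0 := by
  obtain ⟨v, rfl⟩ := GaleDual.mk_surjective _ ξ
  obtain ⟨k, hk, hkc⟩ := F.exists_int_of_ord c
  rw [boxCharacter, GaleDual.circlePairing_mk, nsmul_sub, ← map_nsmul, ← map_nsmul, hk, map_sum,
    sub_eq_zero, nsmul_eq_mul, Finset.mul_sum, map_sum]
  refine Finset.sum_congr rfl fun i _ => ?_
  rw [map_zsmul, GaleDual.cocycle_eq, ← map_zsmul, zsmul_eq_mul, ← hkc, mul_assoc]

theorem boxElement_pow_ord (c : F.NSigma) : F.boxElement c ^ F.ord c = 1 := by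
  refine MonoidHom.ext fun ξ => ?_
  change (Additive.toMul (expQ (F.boxCharacter c ξ.toAdd))) ^ F.ord c = 1
  rw [← toMul_nsmul, ← map_nsmul, ord_nsmul_boxCharacter, map_zero, toMul_zero]

theorem boxOrder_ne_zero (b : F.Box) : F.boxOrder b ≠ 0 :=
  orderOf_ne_zero_iff.2 (isOfFinOrder_iff_pow_eq_one.2
    ⟨_, Nat.pos_of_ne_zero (F.ord_ne_zero _), F.boxElement_pow_ord _⟩)

theorem expQ_age (b : F.Box) (L : F.Pic) :
    expQ (modInt (F.age b L)) = Additive.ofMul (F.boxScalar b L.toMul) :=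
  expQ_rootAge (F.boxOrder_ne_zero b)
    (EquivariantPic.fibreScalar_pow _ _ _ _ _ _ _ (pow_orderOf_eq_one _))

/-- The age modulo `ℤ`, a homomorphism. -/
def ageModInt (b : F.Box) : F.Pic →+ AddCircle (1 : ℚ) where
  toFun L := modInt (F.age b L)
  map_zero' := expQ_injective (by rw [expQ_age, toMul_zero, map_one, ofMul_one, map_zero])
  map_add' L M := expQ_injective (by
    rw [expQ_age, toMul_add, map_mul, ofMul_mul, map_add, expQ_age, expQ_age])

theorem nsmul_ageModInt_toBox (c : F.NSigma) (L : F.Pic) :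
    F.ord c • F.ageModInt (F.toBox c) L = 0 := by
  apply expQ_injective
  have hpow : F.boxElement (F.boxIncl (F.toBox c)) ^ F.ord c = 1 := by
    rw [boxElement_toBox, boxElement_pow_ord]
  have h2 : F.boxScalar (F.toBox c) L.toMul ^ F.ord c = 1 :=
    EquivariantPic.fibreScalar_pow _ _ _ _ _ _ _ hpow
  change expQ (F.ord c • modInt (F.age (F.toBox c) L)) = _
  rw [map_nsmul, expQ_age, ← ofMul_pow, h2, ofMul_one, map_zero]

/-- The `S`-extended Picard group of the toric stack, for a finite set `S` with a map to the box:
the group of pairs `(L, φ)`, `φ : S → ℚ`, such that `φ(b) + age_b(L)` is an integer for all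
`b ∈ S`. -/
def extendedPic {S : Type*} (β : S → F.Box) : AddSubgroup (F.Pic × (S → ℚ)) where
  carrier := {w | ∀ j, ∃ n : ℤ, (n : ℚ) = w.2 j + F.age (β j) w.1}
  zero_mem' j := modInt_eq_zero_iff.1 (by
    have := (F.ageModInt (β j)).map_zero
    change modInt (F.age (β j) 0) = 0 at this
    simp [this])
  add_mem' {v w} hv hw j := modInt_eq_zero_iff.1 (by
    have h1 := modInt_eq_zero_iff.2 (hv j)
    have h2 := modInt_eq_zero_iff.2 (hw j)
    have := (F.ageModInt (β j)).map_add v.1 w.1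
    change modInt (F.age (β j) (v.1 + w.1)) = modInt _ + modInt _ at this
    rw [map_add] at h1 h2 ⊢
    rw [Prod.fst_add, this, Prod.snd_add, Pi.add_apply, map_add, add_add_add_comm, h1, h2,
      add_zero])
  neg_mem' {v} hv j := modInt_eq_zero_iff.1 (by
    have h1 := modInt_eq_zero_iff.2 (hv j)
    have := (F.ageModInt (β j)).map_neg v.1
    change modInt (F.age (β j) (-v.1)) = -modInt _ at this
    rw [map_add] at h1 ⊢
    rw [Prod.fst_neg, this, Prod.snd_neg, Pi.neg_apply, map_neg, ← neg_add, h1, neg_zero])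

/-! #### The extended stacky fan and the exact sequence -/

section Extended

variable {S : Type*} [Fintype S] (s : S → F.NSigma)

/-- The images of the standard basis vectors under `ρ^S : ℤ^{ι ⊔ S} → N`. -/
def extendedRay : ι ⊕ S → N := Sum.elim F.ray (fun j => (s j).1)

/-- The canonical map `ι^* : 𝕃^{S∨} → 𝕃^∨`. -/
def iotaStar : GaleDual (F.extendedRay s) →+ GaleDual F.ray :=
  GaleDual.restrict (F.extendedRay s) Sum.inl

variable [DecidableEq S]

/-- The splitting `μ : ℚ^S → 𝕃^S ⊗ ℚ` on the basis vector of `j ∈ S`: the element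
`e_j - ∑_{i ∈ σ(j)} s_{ji} e_i` of `ℚ^{ι ⊔ S}`, where `s̄_j = ∑_{i ∈ σ(j)} s_{ji} ρ̄_i`. -/
def muVector (j : S) : ι ⊕ S → ℚ := Sum.elim (fun i => -F.coeff (s j) i) (Pi.single j 1)

theorem muVector_mem (j : S) :
    ∑ k, F.muVector s j k • ratImage (F.extendedRay s k) = 0 := by
  simp [Fintype.sum_sum_type, muVector, extendedRay, Pi.single_apply,
    (F.coeff_spec (s j)).2.2, ite_smul]

/-- The dual `μ^* : 𝕃^{S∨} → (𝕃^S)^* → ℚ^S` of `μ`. -/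
def muStar (j : S) : GaleDual (F.extendedRay s) →+ ℚ :=
  GaleDual.ratPairing (F.extendedRay s) (F.muVector s j) (F.muVector_mem s j)

/-- The subgroup `r⁻¹ℤ` of `ℚ`. -/
def invMultiples (r : ℕ) : AddSubgroup ℚ := AddSubgroup.zmultiples ((r : ℚ)⁻¹)

/-- The subgroup `r⁻¹ℤ/ℤ` of `ℚ/ℤ`. -/
def invMultiplesModInt (r : ℕ) : AddSubgroup (AddCircle (1 : ℚ)) := (invMultiples r).map modInt

theorem mem_invMultiples {r : ℕ} (hr : r ≠ 0) {q : ℚ} {n : ℤ} (h : (r : ℚ) * q = n) :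
    q ∈ invMultiples r := by
  refine AddSubgroup.mem_zmultiples_iff.2 ⟨n, ?_⟩
  have hr' : (r : ℚ) ≠ 0 := Nat.cast_ne_zero.2 hr
  rw [zsmul_eq_mul, ← h]
  field_simp

theorem muStar_mem (j : S) (ξ : GaleDual (F.extendedRay s)) :
    F.muStar s j ξ ∈ invMultiples (F.ord (s j)) := by
  obtain ⟨v, rfl⟩ := GaleDual.mk_surjective _ ξ
  obtain ⟨k, hk, hkc⟩ := F.exists_int_of_ord (s j)
  have hval : F.muStar s j (GaleDual.mk _ v) =
      v.1.1 (Sum.inr j) - ∑ i, F.coeff (s j) i * v.1.1 (Sum.inl i) := by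
    change ∑ k, F.muVector s j k * v.1.1 k = _
    simp [Fintype.sum_sum_type, muVector, Pi.single_apply]
    ring
  have h0 : modInt ((F.ord (s j) : ℚ) * F.muStar s j (GaleDual.mk _ v)) = 0 := by
    rw [hval, mul_sub, map_sub, ← nsmul_eq_mul, map_nsmul, ← GaleDual.cocycle_eq, ← map_nsmul]
    change v.1.2 (F.ord (s j) • (s j).1) - _ = 0
    rw [hk, map_sum, sub_eq_zero, Finset.mul_sum, map_sum]
    refine Finset.sum_congr rfl fun i _ => ?_
    rw [← mul_assoc, hkc, map_zsmul, ← zsmul_eq_mul, map_zsmul]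
    congr 1
    exact GaleDual.cocycle_eq _ v (Sum.inl i)
  obtain ⟨n, hn⟩ := modInt_eq_zero_iff.1 h0
  exact mem_invMultiples (F.ord_ne_zero _) hn.symm

/-- The map `(ι^*, μ^*) : 𝕃^{S∨} → 𝕃^∨ ⊕ ⨁_j r_j⁻¹ℤ`. -/
def iotaMu : GaleDual (F.extendedRay s) →+
    GaleDual F.ray × (∀ j, invMultiples (F.ord (s j))) :=
  (F.iotaStar s).prod
    (AddMonoidHom.pi fun j => (F.muStar s j).codRestrict _ (F.muStar_mem s j))

theorem ageModInt_mem (c : F.NSigma) (L : F.Pic) :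
    F.ageModInt (F.toBox c) L ∈ invMultiplesModInt (F.ord c) := by
  refine ⟨F.age (F.toBox c) L, ?_, rfl⟩
  have h := F.nsmul_ageModInt_toBox c L
  change F.ord c • modInt (F.age (F.toBox c) L) = 0 at h
  rw [← map_nsmul, modInt_eq_zero_iff] at h
  obtain ⟨n, hn⟩ := h
  exact mem_invMultiples (F.ord_ne_zero c) (by rw [← nsmul_eq_mul, hn])

/-- The map `(res, can) : 𝕃^∨ ⊕ ⨁_j r_j⁻¹ℤ → ⨁_j r_j⁻¹ℤ/ℤ`. Here `res` takes the ages modulo `ℤ`, at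
the box elements given by the `s_j`, of the line bundle on the toric stack defined by an element
of `𝕃^∨`, and `can` is the projection. -/
def resCan : GaleDual F.ray × (∀ j, invMultiples (F.ord (s j))) →+
    (∀ j, invMultiplesModInt (F.ord (s j))) :=
  AddMonoidHom.pi fun j =>
    (((F.ageModInt (F.toBox (s j))).comp F.toPic).codRestrict _
      fun ξ => F.ageModInt_mem (s j) (F.toPic ξ)).coprod
    (((modInt.comp (invMultiples (F.ord (s j))).subtype).codRestrict
      (invMultiplesModInt (F.ord (s j))) fun q => AddSubgroup.mem_map_of_mem _ q.2).comp
        (Pi.evalAddMonoidHom (fun j => invMultiples (F.ord (s j))) j))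

end Extended

end StackyFan

end

/-! The isomorphism `𝕃^∨ ≅ Pic` rests on two properties of `U`. Its coordinates are those of affine
space, whose polynomial ring is factorial. It also meets every hypersurface, because the empty set
and every `{i}` are cones, so its complement has codimension at least two. An invertible regular
function on `U` is therefore a rational function without zeros or poles along any prime, hence
constant (`eq_of_isRegularOn_univ`). The same divisor calculus trivialises every line bundle on `U`
(`exists_trivialization`): its transition functions are rational, their orders along primes define a
divisor, and this divisor is principal.

An isomorphism from `L_ξ` to the trivial bundle thus amounts to a constant, which forces `ξ(g) = 1`
for all `g`; since `ℚ/ℤ` embeds in `ℂˣ` and separates the elements of any abelian group, `ξ = 0`.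
Conversely, after the underlying bundle of an equivariant bundle is trivialised, each `g` acts by an
invertible function on `U`, that is, by a constant `χ(g)`. This `χ` is a homomorphism `G → ℂˣ`,
regular near `1`, and linear independence of characters shows that it comes from `𝕃^∨`
(`exists_character_eq`).

The exact sequence is a computation with cocycles `(u, χ)`, where `u` is rational, `χ : N → ℚ/ℤ`,
and `u_k ≡ χ(ρ_k)`. The age of `L_ξ` at `b_j` is `∑ s_{ji} u_i - χ(s_j)` modulo `ℤ`, while `μ^*` has
`j`-th component `u_j - ∑ s_{ji} u_i`. Their sum is `u_j - χ(s_j)`, so its vanishing is exactly the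
cocycle condition at the new basis vector `e_{n+j}`: a class of `𝕃^{S∨}` is a class `ξ` of `𝕃^∨`
together with rational numbers `φ(j)` congruent to minus the ages of `L_ξ`. With `𝕃^∨ ≅ Pic`, such
pairs are the elements of `Pic^S`. -/

noncomputable section

/-! ### Orders of vanishing along primes of a factorial ring -/

section PrimeOrd

variable {R K : Type*} [CommRing R] [IsDomain R] [UniqueFactorizationMonoid R] [Field K]
  [Algebra R K] [IsFractionRing R K]

/-- The order of an element of the fraction field along the prime `P`. -/
def primeOrd (P : R) (F : Kˣ) : ℤ :=
  (multiplicity P (IsFractionRing.num R (F : K)) : ℤ) -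
    multiplicity P (IsFractionRing.den R (F : K) : R)

theorem num_ne_zero_of_unit (F : Kˣ) : IsFractionRing.num R (F : K) ≠ 0 := by simp

theorem den_ne_zero_of_unit (F : Kˣ) : (IsFractionRing.den R (F : K) : R) ≠ 0 :=
  nonZeroDivisors.ne_zero (IsFractionRing.den R (F : K)).2

theorem num_mul_eq_mul_den {F : K} {a b : R}
    (h : F * algebraMap R K b = algebraMap R K a) :
    IsFractionRing.num R F * b = a * IsFractionRing.den R F := by
  have hd : algebraMap R K (IsFractionRing.den R F) ≠ 0 := by simp
  have h1 := IsFractionRing.mk'_num_den' R F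
  rw [div_eq_iff hd] at h1
  apply IsFractionRing.injective R K
  rw [map_mul, map_mul, h1, ← h]
  ring

/-- Coprimality of the reduced numerator and denominator makes them divide those of any other
presentation, so nonvanishing at a point may be tested on an arbitrary fraction. -/
theorem den_dvd_of_mul_eq {F : K} {a b : R} (h : F * algebraMap R K b = algebraMap R K a) :
    (IsFractionRing.den R F : R) ∣ b :=
  (IsFractionRing.num_den_reduced R F).symm.dvd_of_dvd_mul_left
    (num_mul_eq_mul_den h ▸ Dvd.intro_left _ rfl)

theorem num_dvd_of_mul_eq {F : K} {a b : R} (h : F * algebraMap R K b = algebraMap R K a) :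
    IsFractionRing.num R F ∣ a :=
  (IsFractionRing.num_den_reduced R F).dvd_of_dvd_mul_right
    (num_mul_eq_mul_den h ▸ Dvd.intro _ rfl)

theorem mul_den_eq_num (F : K) :
    F * algebraMap R K (IsFractionRing.den R F) = algebraMap R K (IsFractionRing.num R F) :=
  IsFractionRing.num_mul_den_eq_num_iff_eq.2 rfl

variable {P : R} (hP : Prime P)
include hP

theorem Prime.multiplicity_mul {a b : R} (ha : a ≠ 0) (hb : b ≠ 0) :
    multiplicity P (a * b) = multiplicity P a + multiplicity P b :=
  _root_.multiplicity_mul hP (.of_prime_left hP (mul_ne_zero ha hb))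

/-- Multiplicities are additive on the cross-multiplied identity, so the order can be read off any
fraction, reduced or not. -/
theorem primeOrd_eq {F : Kˣ} {a b : R} (ha : a ≠ 0) (hb : b ≠ 0)
    (h : (F : K) * algebraMap R K b = algebraMap R K a) :
    primeOrd P F = multiplicity P a - multiplicity P b := by
  have h1 := congrArg (multiplicity P) (num_mul_eq_mul_den h)
  rw [hP.multiplicity_mul (num_ne_zero_of_unit F) hb,
    hP.multiplicity_mul ha (den_ne_zero_of_unit F)] at h1
  rw [primeOrd]
  omega

theorem primeOrd_mul (F H : Kˣ) : primeOrd P (F * H) = primeOrd P F + primeOrd P H := by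
  rw [primeOrd_eq hP (mul_ne_zero (num_ne_zero_of_unit F) (num_ne_zero_of_unit H))
    (mul_ne_zero (den_ne_zero_of_unit F) (den_ne_zero_of_unit H)),
    hP.multiplicity_mul (num_ne_zero_of_unit F) (num_ne_zero_of_unit H),
    hP.multiplicity_mul (den_ne_zero_of_unit F) (den_ne_zero_of_unit H), primeOrd, primeOrd]
  · push_cast
    ring
  · rw [map_mul, map_mul, ← mul_den_eq_num, ← mul_den_eq_num, Units.val_mul]
    ring

/-- The order along a prime as a homomorphism. -/
def primeOrdHom : Kˣ →* Multiplicative ℤ :=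
  MonoidHom.mk' (fun F => Multiplicative.ofAdd (primeOrd P F)) fun F H => by
    rw [primeOrd_mul hP, ofAdd_add]

theorem primeOrd_one : primeOrd P (1 : Kˣ) = 0 := (primeOrdHom (K := K) hP).map_one

theorem primeOrd_zpow (F : Kˣ) (n : ℤ) : primeOrd P (F ^ n) = n * primeOrd P F := by
  have := map_zpow (primeOrdHom (K := K) hP) F n
  rw [← smul_eq_mul]
  exact this

theorem primeOrd_div (F H : Kˣ) : primeOrd P (F / H) = primeOrd P F - primeOrd P H :=
  map_div (primeOrdHom (K := K) hP) F H

omit hP in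
theorem primeOrd_eq_of_associated {Q : R} (h : Associated P Q) (F : Kˣ) :
    primeOrd P F = primeOrd Q F := by
  rw [primeOrd, primeOrd, multiplicity_eq_of_associated_left h,
    multiplicity_eq_of_associated_left h]

omit hP in
/-- Prescribed orders along the prime divisors of a nonzero element are realised by an element of
the fraction field. -/
theorem exists_primeOrd_eq (n : R → ℤ)
    (hn : ∀ P Q, Prime P → Associated P Q → n P = n Q) (q : R) (hq : q ≠ 0) :
    ∃ h : Kˣ, ∀ P, Prime P → (P ∣ q → primeOrd P h = n P) ∧ (¬ P ∣ q → primeOrd P h = 0) := by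
  induction q using UniqueFactorizationMonoid.induction_on_prime with
  | h₁ => exact absurd rfl hq
  | h₂ x hx =>
    exact ⟨1, fun P hP => ⟨fun h => absurd (isUnit_of_dvd_unit h hx) hP.not_isUnit,
      fun _ => primeOrd_one hP⟩⟩
  | h₃ a p ha hp ih =>
    obtain ⟨h, hh⟩ := ih ha
    -- A repeated prime factor must not contribute twice: the power `p ^ n p` is inserted only if
    -- `p` does not already divide `a`.
    by_cases hpa : p ∣ a
    · refine ⟨h, fun P hP => ?_⟩
      have : P ∣ p * a ↔ P ∣ a := ⟨fun H => (hP.dvd_or_dvd H).elim (fun H => H.trans hpa) id,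
        fun H => H.mul_left _⟩
      rw [this]
      exact hh P hP
    · have hp0 : algebraMap R K p ≠ 0 := by simpa using hp.ne_zero
      refine ⟨h * Units.mk0 _ hp0 ^ n p, fun P hP => ?_⟩
      have hordp : primeOrd P (Units.mk0 _ hp0) = multiplicity P p := by
        rw [primeOrd_eq hP hp.ne_zero one_ne_zero (by simp),
          multiplicity_of_isUnit_right hP.not_isUnit isUnit_one, Nat.cast_zero, sub_zero]
      rw [primeOrd_mul hP, primeOrd_zpow hP, hordp]
      by_cases hPp : P ∣ p
      · have has : Associated P p := hP.associated_of_dvd hp hPp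
        have hPa : ¬ P ∣ a := fun H => hpa (has.symm.dvd.trans H)
        refine ⟨fun _ => ?_, fun H => absurd (hPp.mul_right a) H⟩
        rw [(hh P hP).2 hPa, ← multiplicity_eq_of_associated_right has, multiplicity_self,
          hn P p hP has]
        simp
      · have : P ∣ p * a ↔ P ∣ a := ⟨fun H => (hP.dvd_or_dvd H).resolve_left hPp,
          fun H => H.mul_left _⟩
        rw [this, multiplicity_eq_zero.2 hPp]
        simpa using hh P hP

end PrimeOrd

/-! ### Rational functions on affine space that are invertible at a point -/

section RationalFunctions

variable {ι : Type*}

/-- Rational functions on `ℂ^ι`. -/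
abbrev RatFn (ι : Type*) : Type _ := FractionRing (MvPolynomial ι ℂ)

/-- `F` is regular and does not vanish at `z`. -/
def IsUnitAt (F : (RatFn ι)ˣ) (z : ι → ℂ) : Prop :=
  MvPolynomial.eval z (IsFractionRing.num (MvPolynomial ι ℂ) (F : RatFn ι)) ≠ 0 ∧
    MvPolynomial.eval z
      (IsFractionRing.den (MvPolynomial ι ℂ) (F : RatFn ι) : MvPolynomial ι ℂ) ≠ 0

/-- The value of `F` at `z`. -/
def ratEval (F : (RatFn ι)ˣ) (z : ι → ℂ) : ℂ :=
  MvPolynomial.eval z (IsFractionRing.num (MvPolynomial ι ℂ) (F : RatFn ι)) /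
    MvPolynomial.eval z
      (IsFractionRing.den (MvPolynomial ι ℂ) (F : RatFn ι) : MvPolynomial ι ℂ)

theorem eval_ne_zero_of_dvd {p q : MvPolynomial ι ℂ} (h : p ∣ q) {z : ι → ℂ}
    (hq : MvPolynomial.eval z q ≠ 0) : MvPolynomial.eval z p ≠ 0 := by
  obtain ⟨r, rfl⟩ := h
  rw [map_mul] at hq
  exact left_ne_zero_of_mul hq

variable {F H : (RatFn ι)ˣ} {z : ι → ℂ} {p q : MvPolynomial ι ℂ}

theorem isUnitAt_of_mul_eq
    (h : (F : RatFn ι) * algebraMap _ (RatFn ι) q = algebraMap _ (RatFn ι) p)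
    (hp : MvPolynomial.eval z p ≠ 0) (hq : MvPolynomial.eval z q ≠ 0) : IsUnitAt F z :=
  ⟨eval_ne_zero_of_dvd (num_dvd_of_mul_eq h) hp, eval_ne_zero_of_dvd (den_dvd_of_mul_eq h) hq⟩

theorem ratEval_eq (h : (F : RatFn ι) * algebraMap _ (RatFn ι) q = algebraMap _ (RatFn ι) p)
    (hq : MvPolynomial.eval z q ≠ 0) :
    ratEval F z = MvPolynomial.eval z p / MvPolynomial.eval z q := by
  have h1 := congrArg (MvPolynomial.eval z) (num_mul_eq_mul_den h)
  rw [map_mul, map_mul] at h1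
  rw [ratEval, div_eq_div_iff (eval_ne_zero_of_dvd (den_dvd_of_mul_eq h) hq) hq, h1]

theorem IsUnitAt.ratEval_ne_zero (h : IsUnitAt F z) : ratEval F z ≠ 0 := div_ne_zero h.1 h.2

theorem IsUnitAt.div (hF : IsUnitAt F z) (hH : IsUnitAt H z) :
    IsUnitAt (F / H) z ∧ ratEval (F / H) z = ratEval F z / ratEval H z := by
  have key : ((F / H : (RatFn ι)ˣ) : RatFn ι) * algebraMap _ (RatFn ι)
      ((IsFractionRing.den (MvPolynomial ι ℂ) (F : RatFn ι) : MvPolynomial ι ℂ) *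
        IsFractionRing.num (MvPolynomial ι ℂ) (H : RatFn ι)) = algebraMap _ (RatFn ι)
      (IsFractionRing.num (MvPolynomial ι ℂ) (F : RatFn ι) *
        IsFractionRing.den (MvPolynomial ι ℂ) (H : RatFn ι)) := by
    rw [map_mul, map_mul, ← mul_den_eq_num (R := MvPolynomial ι ℂ) (F : RatFn ι),
      ← mul_den_eq_num (R := MvPolynomial ι ℂ) (H : RatFn ι), Units.val_div_eq_div_val]
    have := H.ne_zero
    field_simp
  refine ⟨isUnitAt_of_mul_eq key ?_ ?_, ?_⟩
  · rw [map_mul]; exact mul_ne_zero hF.1 hH.2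
  · rw [map_mul]; exact mul_ne_zero hF.2 hH.1
  · rw [ratEval_eq key (by rw [map_mul]; exact mul_ne_zero hF.2 hH.1), ratEval, ratEval, map_mul,
      map_mul, div_div_div_eq]

/-- A polynomial vanishing at `z` cannot divide a numerator or denominator that is nonzero at `z`.
-/
theorem IsUnitAt.primeOrd_eq_zero (h : IsUnitAt F z) {P : MvPolynomial ι ℂ}
    (hPz : MvPolynomial.eval z P = 0) : primeOrd P F = 0 := by
  rw [primeOrd, multiplicity_eq_zero.2 fun hd => eval_ne_zero_of_dvd hd h.1 hPz,
    multiplicity_eq_zero.2 fun hd => eval_ne_zero_of_dvd hd h.2 hPz, sub_self]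

theorem exists_prime_dvd_eval_eq_zero (hp : p ≠ 0) (hz : MvPolynomial.eval z p = 0) :
    ∃ P, Prime P ∧ P ∣ p ∧ MvPolynomial.eval z P = 0 := by
  induction p using UniqueFactorizationMonoid.induction_on_prime with
  | h₁ => exact absurd rfl hp
  | h₂ x hx => exact absurd hz (hx.map (MvPolynomial.eval z)).ne_zero
  | h₃ a p ha hprime ih =>
    rw [map_mul, mul_eq_zero] at hz
    rcases hz with hz | hz
    · exact ⟨p, hprime, Dvd.intro _ rfl, hz⟩
    · obtain ⟨P, hP, hd, h0⟩ := ih ha hz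
      exact ⟨P, hP, hd.mul_left p, h0⟩

/-- The reduced numerator and denominator are coprime, so a prime dividing one does not divide the
other and the two multiplicities cannot cancel. -/
theorem primeOrd_ne_zero_of_dvd {P : MvPolynomial ι ℂ} (hP : Prime P)
    (h : P ∣ IsFractionRing.num (MvPolynomial ι ℂ) (F : RatFn ι) ∨
      P ∣ (IsFractionRing.den (MvPolynomial ι ℂ) (F : RatFn ι) : MvPolynomial ι ℂ)) :
    primeOrd P F ≠ 0 := by
  have hrel := IsFractionRing.num_den_reduced (MvPolynomial ι ℂ) (F : RatFn ι)
  rw [primeOrd]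
  rcases h with h | h
  · have h1 := multiplicity_ne_zero.2 h
    have h2 := multiplicity_eq_zero.2 (mt (hrel h) hP.not_isUnit)
    omega
  · have h1 := multiplicity_ne_zero.2 h
    have h2 := multiplicity_eq_zero.2 (mt (hrel · h) hP.not_isUnit)
    omega

/-- Factoriality turns a zero or pole at a point into one along a prime: a nonzero polynomial
vanishing at `z` has a prime factor vanishing at `z`. -/
theorem isUnitAt_of_primeOrd_eq_zero
    (h : ∀ P : MvPolynomial ι ℂ, Prime P → MvPolynomial.eval z P = 0 → primeOrd P F = 0) :
    IsUnitAt F z := by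
  constructor
  · intro h0
    obtain ⟨P, hP, hd, hPz⟩ := exists_prime_dvd_eval_eq_zero (num_ne_zero_of_unit F) h0
    exact primeOrd_ne_zero_of_dvd hP (.inl hd) (h P hP hPz)
  · intro h0
    obtain ⟨P, hP, hd, hPz⟩ := exists_prime_dvd_eval_eq_zero (den_ne_zero_of_unit F) h0
    exact primeOrd_ne_zero_of_dvd hP (.inr hd) (h P hP hPz)

/-- A rational function without zeros and poles is constant. -/
theorem ratEval_const_of_primeOrd_eq_zero
    (h : ∀ P : MvPolynomial ι ℂ, Prime P → primeOrd P F = 0) :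
    ∃ c : ℂ, ∀ z, ratEval F z = c := by
  have key : ∀ p : MvPolynomial ι ℂ, p ≠ 0 → (∀ P, Prime P → ¬ P ∣ p) →
      ∃ c : ℂ, ∀ z, MvPolynomial.eval z p = c := fun p hp hd => by
    have hu : IsUnit p := by
      by_contra hu
      obtain ⟨P, hP, hPd⟩ := WfDvdMonoid.exists_irreducible_factor hu hp
      exact hd P hP.prime hPd
    obtain ⟨c, -, hc⟩ := MvPolynomial.isUnit_iff_eq_C_of_isReduced.1 hu
    exact ⟨c, fun z => by rw [hc, MvPolynomial.eval_C]⟩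
  obtain ⟨c, hc⟩ := key _ (num_ne_zero_of_unit F)
    fun P hP hd => primeOrd_ne_zero_of_dvd hP (.inl hd) (h P hP)
  obtain ⟨d, hd⟩ := key _ (den_ne_zero_of_unit F)
    fun P hP hd => primeOrd_ne_zero_of_dvd hP (.inr hd) (h P hP)
  exact ⟨c / d, fun z => by rw [ratEval, hc, hd]⟩

/-- The zero locus of a prime is not contained in that of a polynomial it does not divide. -/
theorem exists_eval_eq_zero_and_ne_zero [Finite ι] {P : MvPolynomial ι ℂ} (hP : Prime P)
    (hq : ¬ P ∣ q) : ∃ z, MvPolynomial.eval z P = 0 ∧ MvPolynomial.eval z q ≠ 0 := by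
  have : (Ideal.span {P}).IsPrime := (Ideal.span_singleton_prime hP.ne_zero).2 hP
  by_contra! H
  apply hq
  -- Nullstellensatz: the prime ideal `(P)` is the vanishing ideal of its zero locus, so a
  -- polynomial vanishing on that locus is a multiple of `P`.
  rw [← Ideal.mem_span_singleton,
    ← MvPolynomial.IsPrime.vanishingIdeal_zeroLocus (K := ℂ) (Ideal.span {P}),
    MvPolynomial.mem_vanishingIdeal_iff]
  intro z hz
  rw [MvPolynomial.mem_zeroLocus_iff] at hz
  simpa using H z (by simpa using hz P (Ideal.mem_span_singleton_self P))

end RationalFunctions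

namespace StackyFan

variable {N : Type*} [AddCommGroup N] [Module.Finite ℤ N] {ι : Type*} [Fintype ι] [DecidableEq ι]
  (F : StackyFan N ι)

/-! ### Functions on the open set `U` -/

section FunctionsOnU

theorem mem_coordU_iff {f : F.U → ℂ} :
    f ∈ F.coordU ↔ ∃ p : MvPolynomial ι ℂ, ∀ z, f z = MvPolynomial.eval z.1 p := by
  have key : ∀ (p : MvPolynomial ι ℂ) (z : F.U),
      MvPolynomial.aeval (fun (i : ι) (z : F.U) => z.1 i) p z = MvPolynomial.eval z.1 p := by
    intro p z
    have := MvPolynomial.comp_aeval_apply (f := fun (i : ι) (z : F.U) => z.1 i)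
      (Pi.evalAlgHom ℂ (fun _ : F.U => ℂ) z) p
    rw [Pi.evalAlgHom_apply] at this
    rw [this, ← MvPolynomial.coe_aeval_eq_eval]
    rfl
  rw [coordU, Algebra.adjoin_range_eq_range_aeval, AlgHom.mem_range]
  exact ⟨fun ⟨p, hp⟩ => ⟨p, fun z => by rw [← hp, key]⟩,
    fun ⟨p, hp⟩ => ⟨p, funext fun z => by rw [key, hp]⟩⟩

theorem eval_mem_coordU (p : MvPolynomial ι ℂ) :
    (fun z : F.U => MvPolynomial.eval z.1 p) ∈ F.coordU :=
  F.mem_coordU_iff.2 ⟨p, fun _ => rfl⟩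

theorem mem_U_of_zeros {z w : ι → ℂ} (hz : z ∈ F.U) (h : ∀ i, w i = 0 → z i = 0) : w ∈ F.U :=
  fun _ hI hw => hz _ hI fun i hi => h i (hw i hi)

/-- Every `{j}` is a cone, so `U` contains the generic points of all coordinate hyperplanes. This is
what keeps the complement of `U` from containing a hypersurface. -/
theorem mem_U_of_subsingleton_zeros {w : ι → ℂ} {j : ι} (h : ∀ i, w i = 0 → i = j) :
    w ∈ F.U := fun _ hI hw => hI (F.face_mem _ (F.singleton_mem j) _ fun i hi =>
  Finset.mem_singleton.2 (h i (hw i (Finset.mem_compl.1 hi))))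

theorem mem_U_of_forall_ne_zero {w : ι → ℂ} (h : ∀ i, w i ≠ 0) : w ∈ F.U := fun _ hI hw =>
  hI (F.face_mem _ F.empty_mem _ fun i hi => absurd (hw i (Finset.mem_compl.1 hi)) (h i))

/-- A Zariski-open subset of `U` is a neighbourhood of its points in `ℂ^ι`. -/
theorem exists_principal_subset {V : Set F.U} (hV : IsZariskiOpen F.coordU V) {z : F.U}
    (hz : z ∈ V) : ∃ q : MvPolynomial ι ℂ, MvPolynomial.eval z.1 q ≠ 0 ∧
      ∀ w, MvPolynomial.eval w q ≠ 0 → ∃ hw : w ∈ F.U, (⟨w, hw⟩ : F.U) ∈ V := by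
  obtain ⟨f, hf, hfz, hfV⟩ := hV z hz
  obtain ⟨p, hp⟩ := F.mem_coordU_iff.1 hf
  -- The factor `∏ X i` over the nonzero coordinates of `z` ensures that `w` vanishes only where `z`
  -- does, which puts `w` in `U`.
  refine ⟨p * ∏ i with z.1 i ≠ 0, MvPolynomial.X i, ?_, fun w hw => ?_⟩
  · rw [map_mul, map_prod, ← hp]
    refine mul_ne_zero hfz (Finset.prod_ne_zero_iff.2 fun i hi => ?_)
    simpa using hi
  · rw [map_mul, map_prod] at hw
    have hw2 := Finset.prod_ne_zero_iff.1 (right_ne_zero_of_mul hw)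
    have hwU : w ∈ F.U := F.mem_U_of_zeros z.2 fun i hi => by
      by_contra hzi
      exact hw2 i (by simpa using hzi) (by simpa using hi)
    refine ⟨hwU, hfV ⟨w, hwU⟩ ?_⟩
    rw [hp]
    exact left_ne_zero_of_mul hw

/-- Zariski density: with `s` cutting out a principal open set inside `V`, the product `p * (q * s)`
vanishes on all of affine space, hence is zero, and the polynomial ring is a domain. -/
theorem eq_zero_of_vanishes_on {V : Set F.U} (hV : IsZariskiOpen F.coordU V) {z : F.U}
    (hz : z ∈ V) {p q : MvPolynomial ι ℂ} (hq : q ≠ 0)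
    (h : ∀ w ∈ V, MvPolynomial.eval w.1 q ≠ 0 → MvPolynomial.eval w.1 p = 0) : p = 0 := by
  obtain ⟨s, hsz, hs⟩ := F.exists_principal_subset hV hz
  have hs0 : s ≠ 0 := by
    rintro rfl
    simp at hsz
  have : p * (q * s) = 0 := MvPolynomial.funext fun w => by
    rw [map_mul, map_mul, map_zero]
    by_cases h1 : MvPolynomial.eval w s = 0
    · rw [h1, mul_zero, mul_zero]
    by_cases h2 : MvPolynomial.eval w q = 0
    · rw [h2, zero_mul, mul_zero]
    obtain ⟨hwU, hwV⟩ := hs w h1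
    rw [h ⟨w, hwU⟩ hwV h2, zero_mul]
  exact (mul_eq_zero.1 this).resolve_right (mul_ne_zero hq hs0)

/-- Irreducibility of `U`: if `V` missed `W`, the polynomial `q` of a principal open set inside `W`
would vanish on `V`, hence identically. -/
theorem inter_nonempty {V W : Set F.U} (hV : IsZariskiOpen F.coordU V)
    (hW : IsZariskiOpen F.coordU W) {z z' : F.U} (hz : z ∈ V) (hz' : z' ∈ W) :
    ∃ w, w ∈ V ∩ W := by
  obtain ⟨q, hqz, hq⟩ := F.exists_principal_subset hW hz'
  by_contra! H
  have hq0 : q ≠ 0 := by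
    rintro rfl
    simp at hqz
  refine hq0 (F.eq_zero_of_vanishes_on hV hz hq0 fun w hw hqw => ?_)
  obtain ⟨hwU, hwW⟩ := hq w hqw
  exact absurd ⟨hw, hwW⟩ (H w)

/-- The part in `U` of the zero locus of a prime is irreducible. -/
theorem exists_mem_inter_eval_eq_zero {V W : Set F.U} (hV : IsZariskiOpen F.coordU V)
    (hW : IsZariskiOpen F.coordU W) {z z' : F.U} (hz : z ∈ V) (hz' : z' ∈ W)
    {P : MvPolynomial ι ℂ} (hP : Prime P) (hPz : MvPolynomial.eval z.1 P = 0)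
    (hPz' : MvPolynomial.eval z'.1 P = 0) : ∃ w ∈ V ∩ W, MvPolynomial.eval w.1 P = 0 := by
  obtain ⟨q, hqz, hq⟩ := F.exists_principal_subset hV hz
  obtain ⟨r, hrz, hr⟩ := F.exists_principal_subset hW hz'
  obtain ⟨w, hPw, hw⟩ := exists_eval_eq_zero_and_ne_zero (q := q * r) hP fun hd =>
    (hP.dvd_or_dvd hd).elim (fun hd => eval_ne_zero_of_dvd hd hqz hPz)
      fun hd => eval_ne_zero_of_dvd hd hrz hPz'
  rw [map_mul] at hw
  obtain ⟨hwU, hwV⟩ := hq w (left_ne_zero_of_mul hw)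
  obtain ⟨_, hwW⟩ := hr w (right_ne_zero_of_mul hw)
  exact ⟨⟨w, hwU⟩, ⟨hwV, hwW⟩, hPw⟩

/-- `U` meets every hypersurface: its complement has codimension at least two. -/
theorem exists_eval_eq_zero {P : MvPolynomial ι ℂ} (hP : Prime P) :
    ∃ z : F.U, MvPolynomial.eval z.1 P = 0 := by
  -- Either `P` is a coordinate up to a unit, and a point with only that coordinate zero lies in
  -- `U`, or the hypersurface meets the torus, which lies in `U`.
  by_cases hd : P ∣ ∏ i : ι, MvPolynomial.X i
  · obtain ⟨i, -, hi⟩ := (hP.dvd_finsetProd_iff _).1 hd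
    refine ⟨⟨Function.update 1 i 0, F.mem_U_of_subsingleton_zeros (j := i) fun k hk => ?_⟩, ?_⟩
    · by_contra hki
      simp [Function.update_of_ne hki] at hk
    · obtain ⟨c, rfl⟩ := (hP.associated_of_dvd MvPolynomial.X_prime hi).symm.dvd
      simp
  · obtain ⟨w, hPw, hw⟩ := exists_eval_eq_zero_and_ne_zero hP hd
    rw [map_prod] at hw
    refine ⟨⟨w, F.mem_U_of_forall_ne_zero fun i => ?_⟩, hPw⟩
    simpa using Finset.prod_ne_zero_iff.1 hw i (Finset.mem_univ i)

/-- An invertible regular function on a nonempty open subset of `U` is rational. -/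
theorem exists_ratEval_eq {V : Set F.U} (hV : IsZariskiOpen F.coordU V) {z₀ : F.U} (hz₀ : z₀ ∈ V)
    {f : F.U → ℂˣ} (hf : IsRegularOn F.coordU V fun z => (f z : ℂ)) :
    ∃ H : (RatFn ι)ˣ, ∀ z ∈ V, IsUnitAt H z.1 ∧ ratEval H z.1 = f z := by
  have hloc : ∀ z ∈ V, ∃ p q : MvPolynomial ι ℂ, MvPolynomial.eval z.1 q ≠ 0 ∧
      ∀ w ∈ V, MvPolynomial.eval w.1 q ≠ 0 →
        (f w : ℂ) = MvPolynomial.eval w.1 p / MvPolynomial.eval w.1 q := fun z hz => by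
    obtain ⟨a, ha, b, hb, hbz, hab⟩ := hf z hz
    obtain ⟨p, hp⟩ := F.mem_coordU_iff.1 ha
    obtain ⟨q, hq⟩ := F.mem_coordU_iff.1 hb
    refine ⟨p, q, by rwa [← hq], fun w hw hqw => ?_⟩
    rw [← hp, ← hq]
    exact hab w hw (by rwa [hq])
  have hne : ∀ {p q : MvPolynomial ι ℂ} {z : F.U}, (f z : ℂ) = MvPolynomial.eval z.1 p /
      MvPolynomial.eval z.1 q → MvPolynomial.eval z.1 p ≠ 0 := fun {p q z} h h0 => by
    rw [h0, zero_div] at h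
    exact (f z).ne_zero h
  obtain ⟨p₀, q₀, hq₀, h₀⟩ := hloc z₀ hz₀
  have hp₀ := hne (h₀ z₀ hz₀ hq₀)
  have hp₀' : algebraMap _ (RatFn ι) p₀ ≠ 0 := by
    rw [Ne, FaithfulSMul.algebraMap_eq_zero_iff]
    rintro rfl
    simp at hp₀
  have hq₀0 : q₀ ≠ 0 := by
    rintro rfl
    simp at hq₀
  have hq₀' : algebraMap _ (RatFn ι) q₀ ≠ 0 := by
    rwa [Ne, FaithfulSMul.algebraMap_eq_zero_iff]
  refine ⟨Units.mk0 _ hp₀' / Units.mk0 _ hq₀', fun z hz => ?_⟩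
  obtain ⟨p, q, hq, h⟩ := hloc z hz
  have hq0 : q ≠ 0 := by
    rintro rfl
    simp at hq
  -- The fraction at the base point `z₀` serves everywhere: any other local fraction agrees with it
  -- on a dense set, so both are the same rational function.
  have heq : p₀ * q - p * q₀ = 0 := F.eq_zero_of_vanishes_on hV hz (mul_ne_zero hq₀0 hq0)
    fun w hw hqw => by
      rw [map_mul] at hqw
      have h1 := h₀ w hw (left_ne_zero_of_mul hqw)
      rw [h w hw (right_ne_zero_of_mul hqw), div_eq_div_iff (right_ne_zero_of_mul hqw)
        (left_ne_zero_of_mul hqw)] at h1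
      rw [map_sub, map_mul, map_mul, h1, sub_self]
  have hF : ((Units.mk0 _ hp₀' / Units.mk0 _ hq₀' : (RatFn ι)ˣ) : RatFn ι) *
      algebraMap _ (RatFn ι) q = algebraMap _ (RatFn ι) p := by
    rw [Units.val_div_eq_div_val, Units.val_mk0, Units.val_mk0, div_mul_eq_mul_div,
      div_eq_iff hq₀', ← map_mul, ← map_mul, sub_eq_zero.1 heq]
  exact ⟨isUnitAt_of_mul_eq hF (hne (h z hz hq)) hq, by rw [ratEval_eq hF hq, h z hz hq]⟩

/-- Rational functions that agree on a nonempty open set are equal. -/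
theorem eq_of_ratEval_eq {V : Set F.U} (hV : IsZariskiOpen F.coordU V) {z : F.U} (hz : z ∈ V)
    {A B : (RatFn ι)ˣ} (hA : ∀ w ∈ V, IsUnitAt A w.1) (hB : ∀ w ∈ V, IsUnitAt B w.1)
    (h : ∀ w ∈ V, ratEval A w.1 = ratEval B w.1) : A = B := by
  apply Units.ext
  refine (IsFractionRing.num_mul_den_eq_num_mul_den_iff_eq (A := MvPolynomial ι ℂ)).1
    (sub_eq_zero.1 (F.eq_zero_of_vanishes_on hV hz one_ne_zero fun w hw _ => ?_))
  have := h w hw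
  rw [ratEval, ratEval, div_eq_div_iff (hA w hw).2 (hB w hw).2] at this
  rw [map_sub, map_mul, map_mul, this, sub_self]

theorem isRegularOn_ratEval {V : Set F.U} {H : (RatFn ι)ˣ} (hH : ∀ z ∈ V, IsUnitAt H z.1) :
    IsRegularOn F.coordU V fun z => ratEval H z.1 :=
  fun z hz => ⟨_, F.eval_mem_coordU _, _, F.eval_mem_coordU _, (hH z hz).2, fun _ _ _ => rfl⟩

/-- An invertible regular function on `U` is constant. -/
theorem eq_of_isRegularOn_univ {f : F.U → ℂˣ}
    (hf : IsRegularOn F.coordU Set.univ fun z => (f z : ℂ)) (z z' : F.U) : f z = f z' := by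
  obtain ⟨H, hH⟩ := F.exists_ratEval_eq IsZariskiOpen.univ (Set.mem_univ z) hf
  -- Each prime vanishes somewhere on `U`, where `H` is a unit; hence `H` has order zero along it.
  obtain ⟨c, hc⟩ := ratEval_const_of_primeOrd_eq_zero (F := H) fun P hP => by
    obtain ⟨w, hw⟩ := F.exists_eval_eq_zero hP
    exact (hH w trivial).1.primeOrd_eq_zero hw
  apply Units.ext
  rw [← (hH z trivial).2, ← (hH z' trivial).2, hc, hc]

/-- Every line bundle on `U` is trivial. -/
theorem exists_trivialization {V : F.U → Set F.U} (hV : ∀ x, IsZariskiOpen F.coordU (V x))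
    (hmem : ∀ x, x ∈ V x) (a : F.U → F.U → F.U → ℂˣ)
    (ha : ∀ x y, IsRegularOn F.coordU (V x ∩ V y) fun z => (a x y z : ℂ))
    (hcoc : ∀ x y t, ∀ z ∈ V x, z ∈ V y → z ∈ V t → a y t z * a x y z = a x t z) :
    ∃ b : F.U → F.U → ℂˣ, (∀ x, IsRegularOn F.coordU (V x) fun z => (b x z : ℂ)) ∧
      ∀ x y, ∀ z ∈ V x, z ∈ V y → a x y z * b x z = b y z := by
  have hrat : ∀ x y, ∃ H : (RatFn ι)ˣ, ∀ z ∈ V x ∩ V y,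
      IsUnitAt H z.1 ∧ ratEval H z.1 = a x y z := fun x y => by
    obtain ⟨w, hw⟩ := F.inter_nonempty (hV x) (hV y) (hmem x) (hmem y)
    exact F.exists_ratEval_eq ((hV x).inter (hV y)) hw (ha x y)
  choose H hH using hrat
  obtain ⟨x₀⟩ : Nonempty F.U := ⟨⟨1, F.mem_U_of_forall_ne_zero fun i => one_ne_zero⟩⟩
  -- The cocycle condition holds on a nonempty triple intersection, hence between rational
  -- functions: the cocycle becomes a coboundary over the function field.
  have hHdiv : ∀ x y, H x y = H x₀ y / H x₀ x := fun x y => by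
    obtain ⟨w, hw⟩ := F.inter_nonempty (hV x) (hV y) (hmem x) (hmem y)
    have hopen := ((hV x).inter (hV y)).inter (hV x₀)
    obtain ⟨w', hw'⟩ := F.inter_nonempty ((hV x).inter (hV y)) (hV x₀) hw (hmem x₀)
    refine F.eq_of_ratEval_eq hopen hw' (fun w hw => (hH x y w hw.1).1)
      (fun w hw => ((hH x₀ y w ⟨hw.2, hw.1.2⟩).1.div (hH x₀ x w ⟨hw.2, hw.1.1⟩).1).1)
      fun w hw => ?_
    rw [((hH x₀ y w ⟨hw.2, hw.1.2⟩).1.div (hH x₀ x w ⟨hw.2, hw.1.1⟩).1).2, (hH x y w hw.1).2,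
      (hH x₀ y w ⟨hw.2, hw.1.2⟩).2, (hH x₀ x w ⟨hw.2, hw.1.1⟩).2,
      ← hcoc x₀ x y w hw.2 hw.1.1 hw.1.2, Units.val_mul,
      mul_div_cancel_right₀ _ (Units.ne_zero _)]
  -- The hypersurface `P = 0` is irreducible, so two charts meeting it have a common point on it.
  -- There `H x y = H x₀ y / H x₀ x` is a unit, so the two orders agree and define one divisor `n`.
  have hord : ∀ P, Prime P → ∀ x y, ∀ z ∈ V x, ∀ z' ∈ V y, MvPolynomial.eval z.1 P = 0 →
      MvPolynomial.eval z'.1 P = 0 → primeOrd P (H x₀ x) = primeOrd P (H x₀ y) :=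
    fun P hP x y z hz z' hz' hPz hPz' => by
      obtain ⟨w, hw, hPw⟩ := F.exists_mem_inter_eval_eq_zero (hV x) (hV y) hz hz' hP hPz hPz'
      have := (hH x y w hw).1.primeOrd_eq_zero hPw
      rw [hHdiv, primeOrd_div hP] at this
      omega
  have hn : ∀ P : MvPolynomial ι ℂ, ∃ n : ℤ, Prime P → ∀ x, ∀ z ∈ V x,
      MvPolynomial.eval z.1 P = 0 → primeOrd P (H x₀ x) = n := fun P => by
    by_cases hP : Prime P
    · obtain ⟨z', hz'⟩ := F.exists_eval_eq_zero hP
      exact ⟨primeOrd P (H x₀ z'), fun hP x z hz hPz => hord P hP x z' z hz z' (hmem z') hPz hz'⟩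
    · exact ⟨0, fun h => absurd h hP⟩
  choose n hn using hn
  -- The divisor `n` has finite support: a prime not dividing `q` meets the chart at `x₀`, where its
  -- order is zero. So `n` is the divisor of a rational function `h`.
  obtain ⟨q, hqz, hq⟩ := F.exists_principal_subset (hV x₀) (hmem x₀)
  obtain ⟨h, hh⟩ := exists_primeOrd_eq (K := RatFn ι) n (fun P Q hP hPQ => by
    obtain ⟨z, hz⟩ := F.exists_eval_eq_zero hP
    have hz' : MvPolynomial.eval z.1 Q = 0 := by
      obtain ⟨c, hc⟩ := hPQ.dvd
      rw [hc, map_mul, hz, zero_mul]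
    rw [← hn P hP z z (hmem z) hz, ← hn Q (hPQ.prime hP) z z (hmem z) hz',
      primeOrd_eq_of_associated hPQ]) q (by
    rintro rfl
    simp at hqz)
  have hunit : ∀ x, ∀ z ∈ V x, IsUnitAt (H x₀ x / h) z.1 := fun x z hz =>
    isUnitAt_of_primeOrd_eq_zero fun P hP hPz => by
      rw [primeOrd_div hP, sub_eq_zero]
      by_cases hd : P ∣ q
      · rw [(hh P hP).1 hd, hn P hP x z hz hPz]
      · rw [(hh P hP).2 hd]
        obtain ⟨r, hrz, hr⟩ := F.exists_principal_subset (hV x) hz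
        obtain ⟨w, hPw, hw⟩ := exists_eval_eq_zero_and_ne_zero (q := q * r) hP fun hd' =>
          (hP.dvd_or_dvd hd').elim hd fun hd' => eval_ne_zero_of_dvd hd' hrz hPz
        rw [map_mul] at hw
        obtain ⟨hwU, hwV⟩ := hq w (left_ne_zero_of_mul hw)
        obtain ⟨_, hwW⟩ := hr w (right_ne_zero_of_mul hw)
        exact (hH x₀ x ⟨w, hwU⟩ ⟨hwV, hwW⟩).1.primeOrd_eq_zero hPw
  classical
  -- The trivialisation over `V x` is `H x₀ x / h`, from which the divisor has been removed; the
  -- value `1` outside `V x` is arbitrary.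
  refine ⟨fun x z => if hz : z ∈ V x then Units.mk0 _ (hunit x z hz).ratEval_ne_zero else 1,
    fun x => ?_, fun x y z hx hy => ?_⟩
  · intro z hz
    obtain ⟨p, hp, q, hq, hqz, H'⟩ := F.isRegularOn_ratEval (hunit x) z hz
    refine ⟨p, hp, q, hq, hqz, fun w hw hqw => ?_⟩
    rw [← H' w hw hqw]
    simp [hw]
  · apply Units.ext
    have h1 := (hunit y z hy).div (hunit x z hx)
    rw [div_div_div_cancel_right, ← hHdiv, (hH x y z ⟨hx, hy⟩).2] at h1
    simp only [hx, hy, dif_pos, Units.val_mul, Units.val_mk0]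
    rw [h1.2, div_mul_cancel₀ _ (hunit x z hx).ratEval_ne_zero]

end FunctionsOnU

end StackyFan

/-! ### Functoriality of regular functions -/

section Regular

variable {X Y : Type*} {A : Subalgebra ℂ (X → ℂ)} {B : Subalgebra ℂ (Y → ℂ)}

theorem comp_mem_of_mem_adjoin {s : Set (X → ℂ)} {φ : Y → X} (h : ∀ f ∈ s, f ∘ φ ∈ B) {f : X → ℂ}
    (hf : f ∈ Algebra.adjoin ℂ s) : f ∘ φ ∈ B := by
  induction hf using Algebra.adjoin_induction with
  | mem f hf => exact h f hf
  | algebraMap c => exact B.algebraMap_mem c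
  | add f g _ _ hf hg => exact B.add_mem hf hg
  | mul f g _ _ hf hg => exact B.mul_mem hf hg

theorem IsZariskiOpen.preimage {V : Set X} (hV : IsZariskiOpen A V) {φ : Y → X}
    (hφ : ∀ f ∈ A, f ∘ φ ∈ B) : IsZariskiOpen B (φ ⁻¹' V) := fun y hy => by
  obtain ⟨q, hq, hqy, H⟩ := hV _ hy
  exact ⟨q ∘ φ, hφ q hq, hqy, fun w hw => H _ hw⟩

theorem IsRegularOn.comp {V : Set X} {f : X → ℂ} (hf : IsRegularOn A V f) {φ : Y → X}
    (hφ : ∀ f ∈ A, f ∘ φ ∈ B) : IsRegularOn B (φ ⁻¹' V) (fun y => f (φ y)) := fun y hy => by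
  obtain ⟨p, hp, q, hq, hqy, H⟩ := hf _ hy
  exact ⟨p ∘ φ, hφ p hp, q ∘ φ, hφ q hq, hqy, fun w hw => H _ hw⟩

theorem IsRegularOn.congr {V : Set X} {f g : X → ℂ} (hf : IsRegularOn A V f)
    (h : ∀ x ∈ V, g x = f x) : IsRegularOn A V g := fun x hx => by
  obtain ⟨p, hp, q, hq, hqx, H⟩ := hf x hx
  exact ⟨p, hp, q, hq, hqx, fun y hy hqy => (h y hy).trans (H y hy hqy)⟩

theorem IsRegularOn.of_locally {V : Set X} {f : X → ℂ}
    (h : ∀ x ∈ V, ∃ W, IsZariskiOpen A W ∧ x ∈ W ∧ IsRegularOn A W f) : IsRegularOn A V f := by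
  intro x hx
  obtain ⟨W, hW, hxW, hf⟩ := h x hx
  obtain ⟨p, hp, q, hq, hqx, H⟩ := hf x hxW
  obtain ⟨r, hr, hrx, hrW⟩ := hW x hxW
  refine ⟨p * r, A.mul_mem hp hr, q * r, A.mul_mem hq hr, mul_ne_zero hqx hrx, fun y _ hy => ?_⟩
  rw [H y (hrW y (right_ne_zero_of_mul hy)) (left_ne_zero_of_mul hy)]
  exact (mul_div_mul_right _ _ (right_ne_zero_of_mul hy)).symm

theorem prodAlgebra_comp_left (x : X) {f : Y × X → ℂ} (hf : f ∈ prodAlgebra B A) :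
    f ∘ (fun y => (y, x)) ∈ B :=
  comp_mem_of_mem_adjoin (by
    rintro _ (⟨b, hb, rfl⟩ | ⟨a, -, rfl⟩)
    · exact hb
    · exact B.algebraMap_mem (a x)) hf

theorem prodAlgebra_comp_right (y : Y) {f : Y × X → ℂ} (hf : f ∈ prodAlgebra B A) :
    f ∘ (fun x => (y, x)) ∈ A :=
  comp_mem_of_mem_adjoin (by
    rintro _ (⟨b, -, rfl⟩ | ⟨a, ha, rfl⟩)
    · exact A.algebraMap_mem (b y)
    · exact ha) hf

end Regular

namespace StackyFan

variable {N : Type*} [AddCommGroup N] [Module.Finite ℤ N] {ι : Type*} [Fintype ι] [DecidableEq ι]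
  (F : StackyFan N ι)

/-! ### Characters of `G` -/

section Characters

theorem coordU_comp_smul (g : F.G) {f : F.U → ℂ} (hf : f ∈ F.coordU) :
    f ∘ (fun z => g • z) ∈ F.coordU :=
  comp_mem_of_mem_adjoin (by
    rintro _ ⟨i, rfl⟩
    exact F.coordU.smul_mem (Algebra.subset_adjoin ⟨i, rfl⟩)
      (F.character (F.divisor i) g : ℂ)) hf

/-- Along the orbit of `z` the `i`-th coordinate is the character of the divisor class `D_i`, scaled
by `z_i`. -/
theorem coordU_comp_orbit (z : F.U) {f : F.U → ℂ} (hf : f ∈ F.coordU) :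
    f ∘ (fun g : F.G => g • z) ∈ F.coordG :=
  comp_mem_of_mem_adjoin (by
    rintro _ ⟨i, rfl⟩
    have := F.coordG.smul_mem (Algebra.subset_adjoin ⟨F.divisor i, rfl⟩) (z.1 i)
    convert this using 1
    funext g
    exact mul_comm _ _) hf

theorem character_add (ξ η : GaleDual F.ray) :
    F.character (ξ + η) = F.character ξ * F.character η :=
  MonoidHom.ext fun g => map_mul (show Multiplicative (GaleDual F.ray) →* ℂˣ from g) _ _

theorem character_zero : F.character 0 = 1 :=
  MonoidHom.ext fun g => map_one (show Multiplicative (GaleDual F.ray) →* ℂˣ from g)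

theorem character_neg (ξ : GaleDual F.ray) : F.character (-ξ) = (F.character ξ)⁻¹ :=
  
  MonoidHom.ext fun g => map_inv (show Multiplicative (GaleDual F.ray) →* ℂˣ from g) _

/-- The elements of `G` separate the elements of `𝕃^∨`. -/
theorem eq_zero_of_character_eq_one {ξ : GaleDual F.ray} (h : ∀ g, F.character ξ g = 1) :
    ξ = 0 := by
  by_contra hξ
  -- Homomorphisms to `ℚ/ℤ` separate elements, and composing one with the injective `expQ` gives an
  -- element of `G`.
  obtain ⟨c, hc⟩ := CharacterModule.exists_character_apply_ne_zero_of_ne_zero hξ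
  refine hc (expQ_injective ?_)
  let c' : GaleDual F.ray →+ AddCircle (1 : ℚ) := c
  rw [map_zero]
  exact h (AddMonoidHom.toMultiplicativeLeft (expQ.comp c'))

/-- Characters with values in `ℂ`, as functions on `G`. -/
def charFn (χ : F.G →* ℂˣ) : F.G → ℂ := fun g => χ g

/-- Dedekind's independence of characters. -/
theorem linearIndependent_charFn : LinearIndependent ℂ F.charFn :=
  (linearIndependent_monoidHom F.G ℂ).comp (fun χ : F.G →* ℂˣ => (Units.coeHom ℂ).comp χ)
    fun _ _ h => MonoidHom.ext fun g => Units.ext (DFunLike.congr_fun h g)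

/-- The characters of elements of `𝕃^∨` are closed under products, so the algebra they generate is
already their linear span. -/
theorem coordG_le_span {f : F.G → ℂ} (hf : f ∈ F.coordG) :
    f ∈ Submodule.span ℂ (F.charFn '' Set.range F.character) := by
  rw [coordG, ← Subalgebra.mem_toSubmodule, Algebra.adjoin_eq_span] at hf
  refine Submodule.span_mono (fun f hf => ?_) hf
  induction hf using Submonoid.closure_induction with
  | mem f hf =>
    obtain ⟨ξ, rfl⟩ := hf
    exact ⟨_, ⟨ξ, rfl⟩, rfl⟩
  | one => exact ⟨_, ⟨0, rfl⟩, by rw [character_zero]; rfl⟩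
  | mul f f' _ _ hf hf' =>
    obtain ⟨_, ⟨ξ, rfl⟩, rfl⟩ := hf
    obtain ⟨_, ⟨η, rfl⟩, rfl⟩ := hf'
    exact ⟨_, ⟨ξ + η, rfl⟩, by rw [character_add]; rfl⟩

/-- A homomorphism `G → ℂˣ` that is regular near one point is the character of an element
of `𝕃^∨`. -/
theorem exists_character_eq (χ : F.G →* ℂˣ) {p q : F.G → ℂ} (hp : p ∈ F.coordG)
    (hq : q ∈ F.coordG) {g₀ : F.G} (hq₀ : q g₀ ≠ 0)
    (h : ∀ g, q g ≠ 0 → (χ g : ℂ) = p g / q g) : ∃ ξ, F.character ξ = χ := by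
  by_contra H
  -- If `χ` is outside the group of characters coming from `𝕃^∨`, its coset is disjoint from that
  -- group, so the two spans meet only in `0`.
  have hdisj : Disjoint (Set.range F.character) ((χ * ·) '' Set.range F.character) := by
    rw [Set.disjoint_left]
    rintro _ ⟨ξ, rfl⟩ ⟨_, ⟨η, rfl⟩, hη⟩
    refine H ⟨ξ - η, ?_⟩
    rw [sub_eq_add_neg, character_add, character_neg, ← hη]
    exact mul_inv_cancel_right χ _
  have hspan := F.linearIndependent_charFn.disjoint_span_image hdisj
  -- The second factor `q` makes the identity hold where `q` vanishes as well, where `p` is not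
  -- controlled. The function lies in both spans, hence is zero, although it is nonzero at `g₀`.
  have hmul : F.charFn χ * (q * q) = p * q := funext fun g => by
    by_cases hg : q g = 0
    · simp [hg]
    · change (χ g : ℂ) * (q g * q g) = p g * q g
      rw [h g hg]
      field_simp
  have h1 : F.charFn χ * (q * q) ∈ Submodule.span ℂ (F.charFn '' Set.range F.character) :=
    hmul ▸ F.coordG_le_span (F.coordG.mul_mem hp hq)
  have h2 : F.charFn χ * (q * q) ∈
      Submodule.span ℂ (F.charFn '' ((χ * ·) '' Set.range F.character)) := by
    have := Submodule.mem_map_of_mem (f := LinearMap.mulLeft ℂ (F.charFn χ))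
      (F.coordG_le_span (F.coordG.mul_mem hq hq))
    rw [Submodule.map_span] at this
    convert! this using 2
    rw [Set.image_image, Set.image_image]
    rfl
  have h0 := congrFun (Submodule.disjoint_def.1 hspan _ h1 h2) g₀
  exact mul_ne_zero (Units.ne_zero (χ g₀)) (mul_ne_zero hq₀ hq₀) h0

end Characters

/-! ### The Picard group of the toric stack -/

section Picard

theorem toPic_injective : Function.Injective F.toPic := by
  rw [injective_iff_map_eq_zero]
  intro ξ hξ
  have h1 : EquivariantPic.mk F.coordG F.coordU (F.characterBundle ξ) =
      EquivariantPic.mk F.coordG F.coordU 1 := by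
    rw [map_one]
    exact Additive.ofMul.injective hξ
  obtain ⟨W, b, hW, hm, -, hb, H⟩ := (Con.eq (EquivariantLineBundle.isoCon _ _)).1 h1
  have H' : ∀ x y g z, z ∈ W x → g • z ∈ W y → b x z = b y (g • z) * F.character ξ g :=
    fun x y g z hx hy => by
      have := H x y g z hx hy
      rwa [show (1 : EquivariantLineBundle F.coordG F.coordU).a x y g z = 1 from rfl, one_mul]
        at this
  -- For `g = 1` the relation says that the local functions agree on overlaps; the diagonal `b z z`
  -- is the global function they glue to.
  have hreg : IsRegularOn F.coordU Set.univ fun z => (b z z : ℂ) :=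
    .of_locally fun x _ => ⟨W x, hW x, hm x, (hb x).congr fun z hz => by
      have := H' x z 1 z hz (by rw [one_smul]; exact hm z)
      rw [one_smul, map_one, mul_one] at this
      rw [this]⟩
  refine F.eq_zero_of_character_eq_one fun g => ?_
  let z : F.U := ⟨1, F.mem_U_of_forall_ne_zero fun i => one_ne_zero⟩
  have h2 := H' z (g • z) g z (hm z) (hm _)
  rw [F.eq_of_isRegularOn_univ hreg z (g • z)] at h2
  exact mul_eq_left.1 h2.symm

/-! ### Equivariant structures on the trivial bundle. -/

variable {F} (L : EquivariantLineBundle F.coordG F.coordU)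

theorem regular_fst (x y : F.U) (g : F.G) :
    IsRegularOn F.coordU (L.V x ∩ (g • ·) ⁻¹' L.V y) fun z => (L.a x y g z : ℂ) :=
  (L.regular x y).comp fun _ hf => prodAlgebra_comp_right g hf

theorem exists_bundle_trivialization :
    ∃ b : F.U → F.U → ℂˣ, (∀ x, IsRegularOn F.coordU (L.V x) fun z => (b x z : ℂ)) ∧
      ∀ x y, ∀ z ∈ L.V x, z ∈ L.V y → L.a x y 1 z * b x z = b y z := by
  refine F.exists_trivialization L.isOpen L.mem (fun x y z => L.a x y 1 z) (fun x y => ?_) ?_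
  · have := regular_fst L x y 1
    simp only [one_smul] at this
    exact this
  · intro x y t z hx hy ht
    have := L.cocycle x y t 1 1 z hx (by rwa [one_smul]) (by rwa [one_mul, one_smul])
    rwa [one_smul, one_mul] at this

/-- Read in a trivialisation of the underlying bundle, `g` acts by an invertible regular function on
`U`. Such a function is constant, and composition of the actions makes the constant multiplicative
in `g`. -/
theorem exists_equivariant_trivialization :
    ∃ (b : F.U → F.U → ℂˣ) (χ : F.G →* ℂˣ),
      (∀ x, IsRegularOn F.coordU (L.V x) fun z => (b x z : ℂ)) ∧
      ∀ x y g z, z ∈ L.V x → g • z ∈ L.V y → L.a x y g z * b x z = χ g * b y (g • z) := by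
  obtain ⟨b, hb, hab⟩ := exists_bundle_trivialization L
  let c : F.G → F.U → ℂˣ := fun g z => L.a z (g • z) g z * b z z * (b (g • z) (g • z))⁻¹
  -- The scalar `c g z` does not depend on the charts at source and target; with charts fixed
  -- locally, regularity in `z` becomes visible.
  have key : ∀ x y g z, z ∈ L.V x → g • z ∈ L.V y →
      c g z = L.a x y g z * b x z * (b y (g • z))⁻¹ := fun x y g z hx hy => by
    have h1 := L.cocycle x z (g • z) 1 g z hx (by rw [one_smul]; exact L.mem z)
      (by rw [mul_one]; exact L.mem _)
    have h2 := L.cocycle x (g • z) y g 1 z hx (L.mem _) (by rwa [one_mul])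
    rw [one_smul, mul_one] at h1
    rw [one_mul, ← h1] at h2
    simp only [c]
    rw [← h2, ← hab x z z hx (L.mem z), ← hab (g • z) y (g • z) (L.mem _) hy, mul_inv]
    generalize L.a (g • z) y 1 (g • z) = u
    apply Units.ext
    simp only [Units.val_mul, Units.val_inv_eq_inv_val]
    have := u.ne_zero
    field_simp
  have hreg : ∀ g, IsRegularOn F.coordU Set.univ fun z => (c g z : ℂ) := fun g =>
    .of_locally fun x _ => ⟨L.V x ∩ (g • ·) ⁻¹' L.V (g • x),
      (L.isOpen x).inter ((L.isOpen (g • x)).preimage fun _ hf => F.coordU_comp_smul g hf),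
      ⟨L.mem x, L.mem (g • x)⟩, by
        have h1 := ((regular_fst L x (g • x) g).mul ((hb x).mono Set.inter_subset_left)).mul
          (((hb (g • x)).inv.comp fun _ hf => F.coordU_comp_smul g hf).mono Set.inter_subset_right)
        exact h1.congr fun z hz => by rw [key x (g • x) g z hz.1 hz.2]; simp⟩
  have hconst : ∀ g z z', c g z = c g z' := fun g =>
    F.eq_of_isRegularOn_univ (hreg g)
  let z₀ : F.U := ⟨1, F.mem_U_of_forall_ne_zero fun i => one_ne_zero⟩
  refine ⟨b, MonoidHom.mk' (fun g => c g z₀) fun h g => ?_, hb, fun x y g z hx hy => ?_⟩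
  -- Constancy allows `c h` to be evaluated at `g • z₀`, the point where the cocycle identity
  -- composes the actions of `g` and `h`.
  · rw [hconst h z₀ (g • z₀), key z₀ ((h * g) • z₀) (h * g) z₀ (L.mem _) (L.mem _),
      key (g • z₀) ((h * g) • z₀) h (g • z₀) (L.mem _) (by rw [mul_smul]; exact L.mem _),
      key z₀ (g • z₀) g z₀ (L.mem _) (L.mem _),
      ← L.cocycle z₀ (g • z₀) ((h * g) • z₀) g h z₀ (L.mem _) (L.mem _) (L.mem _), mul_smul]
    generalize L.a (g • z₀) (h • g • z₀) h (g • z₀) = u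
    generalize L.a z₀ (g • z₀) g z₀ = v
    generalize b (g • z₀) (g • z₀) = w
    generalize b (h • g • z₀) (h • g • z₀) = t
    apply Units.ext
    simp only [Units.val_mul, Units.val_inv_eq_inv_val]
    have := w.ne_zero
    field_simp
  · change _ = c g z₀ * _
    rw [hconst g z₀ z, key x y g z hx hy, inv_mul_cancel_right]

theorem toPic_surjective : Function.Surjective F.toPic := by
  intro L'
  obtain ⟨L, hL⟩ : ∃ M, EquivariantPic.mk F.coordG F.coordU M = L'.toMul := Con.mk'_surjective _
  obtain ⟨b, χ, hb, hab⟩ := exists_equivariant_trivialization L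
  let z₀ : F.U := ⟨1, F.mem_U_of_forall_ne_zero fun i => one_ne_zero⟩
  -- Regularity of `χ` is obtained by restriction to the orbit of `z₀`, for those `g` that keep `z₀`
  -- in its chart.
  have hopen : IsZariskiOpen F.coordG {g : F.G | g • z₀ ∈ L.V z₀} :=
    (L.isOpen z₀).preimage fun _ hf => F.coordU_comp_orbit z₀ hf
  have hreg : IsRegularOn F.coordG {g : F.G | g • z₀ ∈ L.V z₀} fun g => (χ g : ℂ) := by
    have h1 : IsRegularOn F.coordG {g : F.G | g • z₀ ∈ L.V z₀}
        fun g => (L.a z₀ z₀ g z₀ : ℂ) :=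
      ((L.regular z₀ z₀).comp fun _ hf => prodAlgebra_comp_left z₀ hf).mono
        fun g hg => ⟨L.mem z₀, hg⟩
    have h2 : IsRegularOn F.coordG {g : F.G | g • z₀ ∈ L.V z₀}
        fun g => (((b z₀ (g • z₀))⁻¹ : ℂˣ) : ℂ) :=
      (hb z₀).inv.comp fun _ hf => F.coordU_comp_orbit z₀ hf
    have h3 : IsRegularOn F.coordG {g : F.G | g • z₀ ∈ L.V z₀} fun _ => (b z₀ z₀ : ℂ) :=
      .of_mem (F.coordG.algebraMap_mem _)
    refine ((h1.mul h3).mul h2).congr fun g hg => ?_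
    have := hab z₀ z₀ g z₀ (L.mem z₀) hg
    rw [← Units.val_mul, this]
    simp
  have h1 : (1 : F.G) ∈ {g : F.G | g • z₀ ∈ L.V z₀} := by
    change (1 : F.G) • z₀ ∈ L.V z₀
    rw [one_smul]
    exact L.mem z₀
  obtain ⟨p, hp, q, hq, hq1, H⟩ := hreg 1 h1
  -- Multiplying `p` and `q` by `r` makes the fraction valid wherever the new denominator is
  -- nonzero, as `exists_character_eq` requires.
  obtain ⟨r, hr, hr1, hrV⟩ := hopen 1 h1
  obtain ⟨ξ, rfl⟩ := F.exists_character_eq χ (F.coordG.mul_mem hp hr) (F.coordG.mul_mem hq hr)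
    (mul_ne_zero hq1 hr1) fun g hg => by
      refine (H g (hrV g (right_ne_zero_of_mul hg)) (left_ne_zero_of_mul hg)).trans ?_
      exact (mul_div_mul_right _ _ (right_ne_zero_of_mul hg)).symm
  refine ⟨ξ, Additive.toMul.injective ?_⟩
  rw [← hL]
  refine ((Con.eq (EquivariantLineBundle.isoCon F.coordG F.coordU)).2 (?_ :
    EquivariantLineBundle.Iso L (F.characterBundle ξ))).symm
  refine ⟨L.V, fun x z => (b x z)⁻¹, L.isOpen, L.mem, fun x z hz => ⟨hz, trivial⟩,
    fun x => (hb x).inv, fun x y g z hx hy => ?_⟩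
  change F.character ξ g * (b x z)⁻¹ = (b y (g • z))⁻¹ * L.a x y g z
  rw [mul_inv_eq_iff_eq_mul, mul_assoc, hab x y g z hx hy, mul_comm (F.character ξ g),
    inv_mul_cancel_left]

end Picard

end StackyFan

namespace StackyFan

variable {N : Type*} [AddCommGroup N] [Module.Finite ℤ N] {ι : Type*} [Fintype ι] [DecidableEq ι]
  (F : StackyFan N ι)

/-! ### The exact sequence and the extended Picard group -/

section Extended

/-- The box element acts on every fibre of `L_ξ` over a point it fixes by `ξ` evaluated at it, which
is the exponential of the box character; the exponential is injective on `ℚ/ℤ`. -/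
theorem ageModInt_toPic (c : F.NSigma) (ξ : GaleDual F.ray) :
    F.ageModInt (F.toBox c) (F.toPic ξ) = F.boxCharacter c ξ := by
  apply expQ_injective
  change expQ (modInt (F.age (F.toBox c) (F.toPic ξ))) = _
  rw [expQ_age, ← boxCharacter_toBox]
  rfl

variable {S : Type*} (s : S → F.NSigma)

theorem resCan_apply_coe (w : GaleDual F.ray × (∀ j, invMultiples (F.ord (s j)))) (j : S) :
    (F.resCan s w j : AddCircle (1 : ℚ)) = F.boxCharacter (s j) w.1 + modInt (w.2 j : ℚ) := by
  rw [← ageModInt_toPic]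
  rfl

theorem resCan_surjective : Function.Surjective (F.resCan s) := by
  intro y
  choose q hq hqy using fun j => (y j).2
  refine ⟨(0, fun j => ⟨q j, hq j⟩), funext fun j => Subtype.ext ?_⟩
  rw [resCan_apply_coe, map_zero, zero_add]
  exact hqy j

variable [Fintype S] [DecidableEq S]

theorem muStar_mk (j : S) (v : (galeD1 (F.extendedRay s)).ker) :
    F.muStar s j (GaleDual.mk _ v) =
      v.1.1 (Sum.inr j) - ∑ i, F.coeff (s j) i * v.1.1 (Sum.inl i) := by
  change ∑ k, F.muVector s j k * v.1.1 k = _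
  simp [Fintype.sum_sum_type, muVector, Pi.single_apply]
  ring

/-- If `η : N → ℚ` bounds the restricted cocycle, then `μ^* = 0` says `u_j = ∑ s_{ji} η(ρ_i) =
η(s_j)`, so the same `η` bounds the extended cocycle. -/
theorem eq_zero_of_iotaStar_muStar {ξ : GaleDual (F.extendedRay s)} (h : F.iotaStar s ξ = 0)
    (hμ : ∀ j, F.muStar s j ξ = 0) : ξ = 0 := by
  obtain ⟨v, rfl⟩ := GaleDual.mk_surjective _ ξ
  obtain ⟨η, hη⟩ := (QuotientAddGroup.eq_zero_iff _).1 h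
  refine (QuotientAddGroup.eq_zero_iff _).2 ⟨η, ?_⟩
  have hχ : modInt.comp η = v.1.2 := congrArg Prod.snd hη
  have h1 : ∀ i, η (F.ray i) = v.1.1 (Sum.inl i) := fun i => congrFun (congrArg Prod.fst hη) i
  refine Prod.ext (funext fun k => ?_) hχ
  rcases k with i | j
  · exact h1 i
  · have h2 := hμ j
    rw [muStar_mk, sub_eq_zero] at h2
    refine Eq.trans ?_ h2.symm
    simp only [← h1]
    exact GaleDual.hom_eq_sum F.ray _ _ (F.coeff_spec (s j)).2.2 η

/-- The terms `∑ s_{ji} u_i` cancel, and what remains is the cocycle condition `u_j ≡ χ(s_j)`. -/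
theorem modInt_muStar_add (ξ : GaleDual (F.extendedRay s)) (j : S) :
    F.boxCharacter (s j) (F.iotaStar s ξ) + modInt (F.muStar s j ξ) = 0 := by
  obtain ⟨v, rfl⟩ := GaleDual.mk_surjective _ ξ
  have h := GaleDual.cocycle_eq _ v (Sum.inr j)
  rw [muStar_mk, map_sub, ← h]
  change modInt (∑ i, F.coeff (s j) i * v.1.1 (Sum.inl i)) - v.1.2 (s j).1 +
    (v.1.2 (s j).1 - modInt (∑ i, F.coeff (s j) i * v.1.1 (Sum.inl i))) = 0
  abel

/-- The prescribed value of `μ^*` forces `u_j = φ(j) + ∑ s_{ji} u_i`; the hypothesis is exactly the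
cocycle condition for this extension. -/
theorem exists_iotaStar_muStar (ξ : GaleDual F.ray) (φ : S → ℚ)
    (h : ∀ j, F.boxCharacter (s j) ξ + modInt (φ j) = 0) :
    ∃ ζ, F.iotaStar s ζ = ξ ∧ ∀ j, F.muStar s j ζ = φ j := by
  obtain ⟨v, rfl⟩ := GaleDual.mk_surjective _ ξ
  let u : ι ⊕ S → ℚ := Sum.elim v.1.1 fun j => φ j + ∑ i, F.coeff (s j) i * v.1.1 i
  have hu : (u, v.1.2) ∈ (galeD1 (F.extendedRay s)).ker := by
    rw [AddMonoidHom.mem_ker]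
    funext k
    rcases k with i | j
    · exact congrFun (AddMonoidHom.mem_ker.1 v.2) i
    · have hj := h j
      rw [boxCharacter, GaleDual.circlePairing_mk] at hj
      change modInt (φ j + ∑ i, F.coeff (s j) i * v.1.1 i) - v.1.2 (s j).1 = 0
      rw [map_add, ← hj]
      abel
  refine ⟨GaleDual.mk _ ⟨_, hu⟩, rfl, fun j => ?_⟩
  rw [muStar_mk]
  exact add_sub_cancel_right _ _

theorem iotaMu_injective : Function.Injective (F.iotaMu s) := by
  rw [injective_iff_map_eq_zero]
  intro ξ h
  exact F.eq_zero_of_iotaStar_muStar s (congrArg Prod.fst h)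
    fun j => congrArg Subtype.val (congrFun (congrArg Prod.snd h) j)

theorem iotaMu_exact_resCan : Function.Exact (F.iotaMu s) (F.resCan s) := by
  intro w
  constructor
  · intro hw
    obtain ⟨ζ, h1, h2⟩ := F.exists_iotaStar_muStar s w.1 (fun j => w.2 j) fun j => by
      rw [← resCan_apply_coe, hw]
      rfl
    exact ⟨ζ, Prod.ext h1 (funext fun j => Subtype.ext (h2 j))⟩
  · rintro ⟨ζ, rfl⟩
    funext j
    apply Subtype.ext
    rw [resCan_apply_coe]
    exact F.modInt_muStar_add s ζ j

/-- The homomorphism `𝕃^{S∨} → Pic^S`, `ξ ↦ (L_{ι^* ξ}, μ^* ξ)`. -/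
def toExtendedPic :
    GaleDual (F.extendedRay s) →+ F.extendedPic (fun j => F.toBox (s j)) :=
  ((F.toPic.comp (F.iotaStar s)).prod (AddMonoidHom.pi (F.muStar s))).codRestrict _ fun ξ j => by
    refine modInt_eq_zero_iff.1 ?_
    rw [map_add, add_comm]
    change F.ageModInt (F.toBox (s j)) (F.toPic (F.iotaStar s ξ)) + modInt (F.muStar s j ξ) = 0
    rw [ageModInt_toPic, modInt_muStar_add]

theorem toExtendedPic_bijective : Function.Bijective (F.toExtendedPic s) := by
  constructor
  · rw [injective_iff_map_eq_zero]
    intro ξ h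
    have h1 := congrArg Subtype.val h
    exact F.eq_zero_of_iotaStar_muStar s
      ((injective_iff_map_eq_zero F.toPic).1 F.toPic_injective _ (congrArg Prod.fst h1))
      fun j => congrFun (congrArg Prod.snd h1) j
  · rintro ⟨⟨L, φ⟩, hw⟩
    obtain ⟨ξ, rfl⟩ := toPic_surjective L
    obtain ⟨ζ, h1, h2⟩ := F.exists_iotaStar_muStar s ξ φ fun j => by
      have := modInt_eq_zero_iff.2 (hw j)
      rw [map_add, add_comm] at this
      rw [← ageModInt_toPic]
      exact this
    exact ⟨ζ, Subtype.ext (Prod.ext (congrArg F.toPic h1) (funext h2))⟩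

end Extended

end StackyFan

end

theorem mainTheorem7 {N : Type*} [AddCommGroup N] [Module.Finite ℤ N]
    {ι : Type*} [Fintype ι] [DecidableEq ι] (F : StackyFan N ι)
    {S : Type*} [Fintype S] [DecidableEq S] (s : S → F.NSigma) :
    (Function.Injective (F.iotaMu s) ∧ Function.Exact (F.iotaMu s) (F.resCan s) ∧
      Function.Surjective (F.resCan s)) ∧
    Function.Bijective F.toPic ∧
    ∃ Φ : F.extendedPic (fun j => F.toBox (s j)) ≃+ GaleDual (F.extendedRay s),
      ∀ w : F.extendedPic (fun j => F.toBox (s j)),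
        F.toPic (F.iotaStar s (Φ w)) = w.1.1 ∧ ∀ j, F.muStar s j (Φ w) = w.1.2 j := by
  refine ⟨⟨F.iotaMu_injective s, F.iotaMu_exact_resCan s, F.resCan_surjective s⟩,
    ⟨F.toPic_injective, StackyFan.toPic_surjective⟩,
    -- Since `Φ` is the inverse of `ξ ↦ (L_{ι^* ξ}, μ^* ξ)`, the two required identities are the
    -- components of that map applied to `Φ w`.
    (AddEquiv.ofBijective _ (F.toExtendedPic_bijective s)).symm, fun w => ?_⟩
  have h := congrArg Subtype.val
    ((AddEquiv.ofBijective _ (F.toExtendedPic_bijective s)).apply_symm_apply w)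
  exact ⟨congrArg Prod.fst h, fun j => congrFun (congrArg Prod.snd h) j⟩
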